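/- Conventions. Rings are associative with unit and modules are left modules. For a commutative noetherian ring $R$, write $\operatorname{refl}R$ for the finitely generated reflexive $R$-modules, and $\operatorname{CM}R$ for the finitely generated $R$-modules $X$ with $\operatorname{depth}_{R_{\mathfrak p}}(X\otimes_R R_{\mathfrak p})=\dim R_{\mathfrak p}$ for all $\mathfrak p\in\operatorname{Supp}_R X$. For an $R$-module $M$ put $A=\operatorname{End}_R(M)$ and $A_{\mathfrak p}=A\otimes_R R_{\mathfrak p}$. If $M\in\operatorname{refl}R$, one says that * $M$ gives a *modification* of $R$ if $A\in\operatorname{CM}R$; * $M$ gives a *Gorenstein modification* (GM) of $R$ if $A\in\operatorname{CM}R$ and $\operatorname{inj.dim}_{A_{\mathfrak p}}A_{\mathfrak p}=\dim R_{\mathfrak p}$ for all $\mathfrak p\in\operatorname{Supp}_R A$; * $M$ gives a *noncommutative crepant resolution* (NCCR) of $R$ if $A\in\operatorname{CM}R$ and $\operatorname{gl.dim}A_{\mathfrak p}=\dim R_{\mathfrak p}$ for all $\mathfrak p\in\operatorname{Supp}_R A$; * $M$ gives a *noncommutative resolution* (NCR) of $R$ if $\operatorname{gl.dim}A_{\mathfrak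 p}<\infty$ for all $\mathfrak p\in\operatorname{Spec}R$. For a group $G$, written additively, a $G$-graded commutative ring $S=\bigoplus_{g\in G}S_g$ is called *strongly $G$-graded* if the natural map $S_h\to\operatorname{Hom}_{S_0}(S_g,S_{g+h})$, $x\mapsto(y\mapsto yx)$, is an isomorphism for all $g,h\in G$. Theorem. Let $G$ be a finite abelian group and $S$ a commutative strongly $G$-graded ring such that $R:=S_0$ is a noetherian normal domain and $S$ is a finitely generated $R$-module. Let $N$ be a finitely generated $G$-graded $S$-module that is reflexive over $S$. 1. $N$ gives a modification of $S$ if and only if $N$ gives a modification of $R$. (That $N$ gives a modification, GM, NCCR or NCR of $R$ includes $N\in\operatorname{refl}R$.) 2. If $N$ gives a GM (respectively, NCCR, NCR) of $S$, then $N$ gives a GM (respectively, NCCR, NCR) of $R$. If $|G|$ is invertible in $R$, then conversely, if $N$ gives a GM (respectively, NCCR, NCR) of $R$, then $N$ gives a GM (respectively, NCCR, NCR) of $S$. -/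

import Mathlib

open CategoryTheory
open scoped TensorProduct

universe u v

/-- The depth of a module `M` over a local ring `R`: the supremum of the lengths of the
`M`-regular sequences in the maximal ideal of `R`. -/
noncomputable def localDepth (R : Type u) [CommRing R] [IsLocalRing R]
    (M : Type v) [AddCommGroup M] [Module R M] : ℕ∞ :=
  ⨆ (rs : List R) (_ : RingTheory.Sequence.IsRegular M rs)
    (_ : ∀ r ∈ rs, r ∈ IsLocalRing.maximalIdeal R), (rs.length : ℕ∞)

/-- `M ∈ CM R`: the `R`-module `M` is finitely generated and
`depth (R_p ⊗ M) = dim R_p` for all `p` in the support of `M`. -/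
structure IsCMModule (R : Type u) [CommRing R] (M : Type v) [AddCommGroup M] [Module R M] :
    Prop where
  finite : Module.Finite R M
  depth_eq : ∀ p ∈ Module.support R M,
    (localDepth (Localization.AtPrime p.asIdeal)
        (Localization.AtPrime p.asIdeal ⊗[R] M) : WithBot ℕ∞) =
      ringKrullDim (Localization.AtPrime p.asIdeal)

/-- The (left) global dimension of a ring `A`: the supremum of the projective dimensions of all
left `A`-modules. -/
noncomputable def globalDim (A : Type u) [Ring A] : WithBot ℕ∞ :=
  ⨆ X : ModuleCat.{u} A, projectiveDimension X

/-- The injective dimension of a ring `A` as a left module over itself. -/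
noncomputable def selfInjDim (A : Type u) [Ring A] : WithBot ℕ∞ :=
  injectiveDimension (ModuleCat.of A A)

/-- The ring `R_p ⊗ End_R(M)`. -/
abbrev LocalEnd (R : Type u) [CommRing R] (M : Type v) [AddCommGroup M] [Module R M]
    (p : PrimeSpectrum R) : Type (max u v) :=
  Localization.AtPrime p.asIdeal ⊗[R] Module.End R M

/-- `M ∈ refl R`: the `R`-module `M` is finitely generated and reflexive. -/
structure IsReflMod (R : Type u) [CommRing R] (M : Type v) [AddCommGroup M] [Module R M] :
    Prop where
  finite : Module.Finite R M
  reflexive : Module.IsReflexive R M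

/-- `M` gives a modification of `R`. -/
structure GivesModification (R : Type u) [CommRing R] (M : Type v) [AddCommGroup M]
    [Module R M] : Prop where
  refl : IsReflMod R M
  cm : IsCMModule R (Module.End R M)

/-- `M` gives a Gorenstein modification (GM) of `R`. -/
structure GivesGM (R : Type u) [CommRing R] (M : Type v) [AddCommGroup M]
    [Module R M] : Prop where
  refl : IsReflMod R M
  cm : IsCMModule R (Module.End R M)
  injDim_eq : ∀ p ∈ Module.support R (Module.End R M),
    selfInjDim (LocalEnd R M p) = ringKrullDim (Localization.AtPrime p.asIdeal)

/-- `M` gives a noncommutative crepant resolution (NCCR) of `R`. -/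
structure GivesNCCR (R : Type u) [CommRing R] (M : Type v) [AddCommGroup M]
    [Module R M] : Prop where
  refl : IsReflMod R M
  cm : IsCMModule R (Module.End R M)
  globalDim_eq : ∀ p ∈ Module.support R (Module.End R M),
    globalDim (LocalEnd R M p) = ringKrullDim (Localization.AtPrime p.asIdeal)

/-- `M` gives a noncommutative resolution (NCR) of `R`. -/
structure GivesNCR (R : Type u) [CommRing R] (M : Type v) [AddCommGroup M]
    [Module R M] : Prop where
  refl : IsReflMod R M
  globalDim_lt_top : ∀ p : PrimeSpectrum R, globalDim (LocalEnd R M p) < ⊤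

section Graded

variable {R : Type u} {S : Type v} {G : Type*} [CommRing R] [CommRing S] [Algebra R S]
  [AddCommGroup G]

/-- The natural map `S_h → Hom_R(S_g, S_{g+h})`, `x ↦ (y ↦ y x)`, of a graded ring `S`. -/
def gradedMulHom (𝒜 : G → Submodule R S) [SetLike.GradedMonoid 𝒜] (g h : G) (x : 𝒜 h) :
    𝒜 g →ₗ[R] 𝒜 (g + h) where
  toFun y := ⟨(y : S) * (x : S), SetLike.mul_mem_graded y.2 x.2⟩
  map_add' y z := Subtype.ext (add_mul (y : S) (z : S) (x : S))
  map_smul' r y := Subtype.ext (smul_mul_assoc r (y : S) (x : S))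

/-- A `G`-graded ring `S` with degree zero part `R` is strongly graded if the natural map
`S_h → Hom_R(S_g, S_{g+h})` is an isomorphism for all `g` and `h`.  The first field says that `R`
is the degree zero part: the structure map `R → S_0` is an isomorphism. -/
structure IsStronglyGraded (𝒜 : G → Submodule R S) [SetLike.GradedMonoid 𝒜] : Prop where
  bijective_zero : Function.Bijective (algebraMap R (𝒜 0))
  bijective_mul : ∀ g h : G, Function.Bijective (gradedMulHom 𝒜 g h)

end Graded

/-! Write A = End_R(N) and B = End_S(N), with B contained in A. The whole theorem rests on the
structure of this extension. Let e_h in A be the projection of N onto its component of degree h.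
Strong grading says that S → Hom_R(S_g, S) is bijective for every g, and reflexivity of N over S
carries this over to N → Hom_R(S_g, N). Consequently an R-linear map defined on a single component
N_h extends in exactly one way to an S-linear endomorphism of N, so A is free as a left B-module on
the idempotents e_h, and homogeneous elements of B permute the e_h by translation: A is a smash
product of B (`isSmashExtension_end`).

For such an extension, restriction of modules from A to B is exact and both preserves and reflects
injectivity (`injective_restrictScalars`, `injective_of_restrictScalars`), so injective dimensions
over A can be computed over B. As A is a finite power of B over B, the self-injective dimensions
agree, and the global dimension of A is at most that of B. If |G| is invertible, averaging over the
e_h splits B off A as a bimodule, so every B-module is a retract of a coinduced one and the global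
dimensions agree (`globalDim_le_left`). All this survives localization at a prime p of R.

It remains to compare B over R_p with B over S_q for the primes q above p. Over the noetherian ring
B_p injectivity is detected on these further localizations (`selfInjDim_le_iff_forall_liesOver`,
`globalDim_le_iff_forall_liesOver`). Depth at p is likewise detected at the q above p
(`HasDepthAt.of_forall_liesOver`, `HasDepthAt.of_liesOver`). The dimensions of R_p and S_q agree by
going down, as S is integral and torsion-free over the normal domain R.

These comparisons give upper bounds for homological dimensions. The equalities with dim R_p follow
because a regular sequence from the centre forces a nonzero Ext, so a Cohen-Macaulay algebra has
self-injective, hence also global, dimension at least dim R_p (`length_le_selfInjDim`). Finally, the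
degree zero projection S → R identifies S with Hom_R(S, R), whence reflexivity over S implies
reflexivity over R. -/

namespace ModuleCat

/-! ### Injective dimension under exact constructions -/

section Functor

variable {A B : Type u} [Ring A] [Ring B]

/-- An exact construction on modules that preserves injective objects does not raise the
injective dimension. -/
lemma hasInjectiveDimensionLE_obj (F : ModuleCat.{u} A → ModuleCat.{u} B)
    (hF : ∀ S : ShortComplex (ModuleCat.{u} A), S.ShortExact →
      ∃ T : ShortComplex (ModuleCat.{u} B), T.ShortExact ∧ T.X₁ = F S.X₁ ∧
        T.X₂ = F S.X₂ ∧ T.X₃ = F S.X₃)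
    (hinj : ∀ I : ModuleCat.{u} A, Injective I → Injective (F I))
    (n : ℕ) (Y : ModuleCat.{u} A) (hY : HasInjectiveDimensionLE Y n) :
    HasInjectiveDimensionLE (F Y) n := by
  induction n generalizing Y with
  | zero =>
    have := hinj Y (injective_iff_hasInjectiveDimensionLT_one.2 hY)
    exact injective_iff_hasInjectiveDimensionLT_one.1 this
  | succ n ih =>
    obtain ⟨⟨I, _, f, _⟩⟩ := EnoughInjectives.presentation Y
    let S : ShortComplex (ModuleCat.{u} A) := ShortComplex.mk f (Limits.cokernel.π f) (by simp)
    have hS : S.ShortExact := { exact := ShortComplex.exact_cokernel f }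
    have h3 := ih S.X₃ ((hS.hasInjectiveDimensionLT_X₃_iff n ‹_›).2 hY)
    obtain ⟨T, hT, h₁, h₂, h₃⟩ := hF S hS
    rw [← h₁]
    rw [← h₃] at h3
    exact (hT.hasInjectiveDimensionLT_X₃_iff n (h₂ ▸ hinj I ‹_›)).1 h3

/-- A family of exact constructions on modules that preserves injective objects and jointly
reflects them also jointly reflects bounds on the injective dimension. -/
lemma hasInjectiveDimensionLE_of_obj {ι : Type*} {B : ι → Type u} [∀ i, Ring (B i)]
    (F : ∀ i, ModuleCat.{u} A → ModuleCat.{u} (B i))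
    (hF : ∀ (i) (S : ShortComplex (ModuleCat.{u} A)), S.ShortExact →
      ∃ T : ShortComplex (ModuleCat.{u} (B i)), T.ShortExact ∧ T.X₁ = F i S.X₁ ∧
        T.X₂ = F i S.X₂ ∧ T.X₃ = F i S.X₃)
    (hinj : ∀ (i) (I : ModuleCat.{u} A), Injective I → Injective (F i I))
    (hrefl : ∀ I : ModuleCat.{u} A, (∀ i, Injective (F i I)) → Injective I)
    (n : ℕ) (Y : ModuleCat.{u} A) (hY : ∀ i, HasInjectiveDimensionLE (F i Y) n) :
    HasInjectiveDimensionLE Y n := by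
  induction n generalizing Y with
  | zero =>
    have := hrefl Y fun i ↦ injective_iff_hasInjectiveDimensionLT_one.2 (hY i)
    exact injective_iff_hasInjectiveDimensionLT_one.1 this
  | succ n ih =>
    obtain ⟨⟨I, _, f, _⟩⟩ := EnoughInjectives.presentation Y
    let S : ShortComplex (ModuleCat.{u} A) := ShortComplex.mk f (Limits.cokernel.π f) (by simp)
    have hS : S.ShortExact := { exact := ShortComplex.exact_cokernel f }
    refine (hS.hasInjectiveDimensionLT_X₃_iff n ‹_›).1 (ih S.X₃ fun i ↦ ?_)
    obtain ⟨T, hT, h₁, h₂, h₃⟩ := hF i S hS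
    rw [← h₃]
    refine (hT.hasInjectiveDimensionLT_X₃_iff n (h₂ ▸ hinj i I ‹_›)).2 ?_
    rw [h₁]
    exact hY i

/-- Restriction leaves the underlying maps unchanged. The statement has the shape of the hypothesis
`hF` above, which suits localization as well, where only the objects are constructed. -/
lemma exists_shortExact_restrictScalars (f : B →+* A) (S : ShortComplex (ModuleCat.{u} A))
    (hS : S.ShortExact) :
    ∃ T : ShortComplex (ModuleCat.{u} B), T.ShortExact ∧ T.X₁ = (restrictScalars f).obj S.X₁ ∧
        T.X₂ = (restrictScalars f).obj S.X₂ ∧ T.X₃ = (restrictScalars f).obj S.X₃ := by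
  refine ⟨S.map (restrictScalars f), ?_, rfl, rfl, rfl⟩
  have h1 := (ShortComplex.ShortExact.moduleCat_exact_iff_function_exact S).1 hS.exact
  have h2 := (mono_iff_injective _).1 hS.mono_f
  have h3 := (epi_iff_surjective _).1 hS.epi_g
  exact
    { exact := (ShortComplex.ShortExact.moduleCat_exact_iff_function_exact _).2 h1
      mono_f := (mono_iff_injective _).2 h2
      epi_g := (epi_iff_surjective _).2 h3 }

end Functor

lemma hasInjectiveDimensionLE_pi {B : Type u} [Ring B] (n : ℕ)
    (h : HasInjectiveDimensionLE (of B B) n) (k : ℕ) :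
    HasInjectiveDimensionLE (of B (Fin k → B)) n := by
  induction k with
  | zero =>
    have : Limits.IsZero (of B (Fin 0 → B)) :=
      ModuleCat.isZero_of_iff_subsingleton.2 inferInstance
    have := this.hasInjectiveDimensionLT_zero
    exact hasInjectiveDimensionLT_of_ge _ 0 _ (by simp)
  | succ k ih =>
    let f : B →ₗ[B] (Fin (k + 1) → B) := LinearMap.single B (fun _ ↦ B) 0
    let g : (Fin (k + 1) → B) →ₗ[B] (Fin k → B) := LinearMap.funLeft B B Fin.succ
    have hfg : Function.Exact f g := by
      intro x
      constructor
      · intro hx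
        refine ⟨x 0, funext fun i ↦ ?_⟩
        refine Fin.cases ?_ (fun j ↦ ?_) i
        · simp [f]
        · have := congrFun hx j
          simpa [f, g, LinearMap.funLeft, Fin.succ_ne_zero] using this.symm
      · rintro ⟨y, rfl⟩
        ext j
        simp [f, g, LinearMap.funLeft, Fin.succ_ne_zero]
    have hS := ModuleCat.shortComplex_shortExact
      (ModuleCat.shortComplexOfCompEqZero f g hfg.linearMap_comp_eq_zero) hfg
      (fun x y hxy ↦ by simpa [f] using congrFun hxy 0)
      (fun y ↦ ⟨Fin.cons 0 y, by ext j; simp [g, LinearMap.funLeft]⟩)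
    exact hS.hasInjectiveDimensionLT_X₂ _ h ih

end ModuleCat

/-! ### Global dimension through injective dimension -/

section GlobalDim

variable {A : Type u} [Ring A]

/-- Both sides say that Ext^i(X, Y) vanishes for all X, Y and all i ≥ n. Global dimension thereby
becomes a question about injectives, where Baer's criterion is available. -/
lemma forall_hasProjectiveDimensionLT_iff (n : ℕ) :
    (∀ X : ModuleCat.{u} A, HasProjectiveDimensionLT X n) ↔
      ∀ Y : ModuleCat.{u} A, HasInjectiveDimensionLT Y n := by
  constructor
  · intro h Y
    rw [hasInjectiveDimensionLT_iff]
    intro i hi X e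
    exact (hasProjectiveDimensionLT_iff X n).1 (h X) i hi e
  · intro h X
    rw [hasProjectiveDimensionLT_iff]
    intro i hi Y e
    exact (hasInjectiveDimensionLT_iff Y n).1 (h Y) i hi e

lemma globalDim_le_iff (n : ℕ) :
    globalDim A ≤ n ↔ ∀ Y : ModuleCat.{u} A, HasInjectiveDimensionLE Y n := by
  rw [globalDim, iSup_le_iff, ← forall_hasProjectiveDimensionLT_iff]
  exact forall_congr' fun X ↦ projectiveDimension_le_iff X n

lemma globalDim_lt_top_iff :
    globalDim A < ⊤ ↔ ∃ n : ℕ, ∀ Y : ModuleCat.{u} A, HasInjectiveDimensionLE Y n := by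
  simp only [← globalDim_le_iff]
  constructor
  · intro h
    generalize globalDim A = d at h
    induction d with
    | bot => exact ⟨0, bot_le⟩
    | coe d =>
      induction d with
      | top => exact absurd h (lt_irrefl _)
      | coe d => exact ⟨d, le_rfl⟩
  · rintro ⟨n, hn⟩
    exact lt_of_le_of_lt hn (WithBot.coe_lt_coe.2 (ENat.natCast_lt_top n))

lemma selfInjDim_le_iff (n : ℕ) :
    selfInjDim A ≤ n ↔ HasInjectiveDimensionLE (ModuleCat.of A A) n :=
  injectiveDimension_le_iff _ n

lemma le_selfInjDim_iff (n : ℕ) :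
    n ≤ selfInjDim A ↔ ¬ HasInjectiveDimensionLT (ModuleCat.of A A) n :=
  injectiveDimension_ge_iff _ n

lemma le_globalDim_of_le_selfInjDim (n : ℕ) (h : n ≤ selfInjDim A) : n ≤ globalDim A := by
  rw [le_selfInjDim_iff] at h
  by_contra! hlt
  apply h
  refine (forall_hasProjectiveDimensionLT_iff n).1 (fun X ↦ ?_) _
  rw [← projectiveDimension_lt_iff]
  exact lt_of_le_of_lt (le_iSup (fun X : ModuleCat.{u} A ↦ projectiveDimension X) X) hlt

lemma hasInjectiveDimensionLE_of_subsingleton [Subsingleton A] (n : ℕ) (Y : ModuleCat.{u} A) :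
    HasInjectiveDimensionLE Y n := by
  have : Subsingleton Y := Module.subsingleton A Y
  have : Limits.IsZero Y := ModuleCat.isZero_of_subsingleton Y
  have := this.hasInjectiveDimensionLT_zero
  exact hasInjectiveDimensionLT_of_ge _ 0 _ (by simp)

end GlobalDim

/-- A ring extension `ι : B → A` of smash product type: `A` contains a complete family of
orthogonal idempotents `e h`, indexed by a finite group, that form a basis of `A` as a left
`B`-module, and every element of `B` is a sum of homogeneous elements, which permute the `e h` by
translation. -/
structure IsSmashExtension {G : Type*} [AddCommGroup G] [Fintype G] [DecidableEq G]
    {A B : Type u} [Ring A] [Ring B] (ι : B →+* A) (e : G → A) : Prop where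
  sum_eq_one : ∑ h, e h = 1
  mul_eq (h k : G) : e h * e k = if h = k then e h else 0
  exists_homogeneous (b : B) : ∃ c : G → B, b = ∑ g, c g ∧
    ∀ g h, ι (c g) * e h = e (h + g) * ι (c g)
  bijective : Function.Bijective fun b : G → B ↦ ∑ h, ι (b h) * e h

/-! ### Homological algebra of smash product extensions -/

namespace IsSmashExtension

open ModuleCat

variable {G : Type*} [AddCommGroup G] [Fintype G] [DecidableEq G]
    {A B : Type u} [Ring A] [Ring B] {ι : B →+* A} {e : G → A} (H : IsSmashExtension ι e)
include H

lemma mul_self (h : G) : e h * e h = e h := by simp [H.mul_eq]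

lemma induction_on {P : A → Prop} (a : A) (zero : P 0) (add : ∀ x y, P x → P y → P (x + y))
    (homogeneous : ∀ (b : B) (g : G), (∀ h, ι b * e h = e (h + g) * ι b) → ∀ h, P (ι b * e h)) :
    P a := by
  obtain ⟨b, rfl⟩ := H.bijective.2 a
  refine Finset.sum_induction _ P add zero fun h _ ↦ ?_
  obtain ⟨c, hc, hc'⟩ := H.exists_homogeneous (b h)
  rw [hc, map_sum, Finset.sum_mul]
  exact Finset.sum_induction _ P add zero fun g _ ↦ homogeneous _ g (hc' g) h

lemma induction_left {P : B → Prop} (b : B) (zero : P 0) (add : ∀ x y, P x → P y → P (x + y))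
    (homogeneous : ∀ (b : B) (g : G), (∀ h, ι b * e h = e (h + g) * ι b) → P b) : P b := by
  obtain ⟨c, rfl, hc'⟩ := H.exists_homogeneous b
  exact Finset.sum_induction _ P add zero fun g _ ↦ homogeneous _ g (hc' g)

omit [Fintype G] [DecidableEq G] H in
lemma mul_eq_of_homogeneous {b : B} {g : G}
    (hb : ∀ h, ι b * e h = e (h + g) * ι b) (h : G) : e h * ι b = ι b * e (h - g) := by
  rw [hb, sub_add_cancel]

lemma eq_zero_of_mul_eq_zero {b : B} {h : G} (hb : ι b * e h = 0) : b = 0 := by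
  have := @H.bijective.1 (Pi.single h b) 0 (by
    simp only [Pi.zero_apply, map_zero, zero_mul, Finset.sum_const_zero]
    rw [Finset.sum_eq_single h] <;> simp +contextual [hb])
  simpa using congrFun this h

/-- Right multiplication of `e k * ι b` by `e (k - g)` isolates the degree g component of b. It
follows that the e k are also independent over B on the other side. -/
lemma eq_zero_of_mul_eq_zero_left {b : B} {k : G} (hb : e k * ι b = 0) : b = 0 := by
  obtain ⟨c, rfl, hc⟩ := H.exists_homogeneous b
  refine Finset.sum_eq_zero fun g _ ↦ H.eq_zero_of_mul_eq_zero (h := k - g) ?_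
  have h1 : e k * ι (∑ g, c g) * e (k - g) = 0 := by rw [hb, zero_mul]
  rw [map_sum, Finset.mul_sum, Finset.sum_mul, Finset.sum_eq_single g] at h1
  · rw [mul_eq_of_homogeneous (hc g), mul_assoc, H.mul_self] at h1
    exact h1
  · intro g' _ hg'
    rw [mul_assoc, hc, ← mul_assoc, H.mul_eq, if_neg, zero_mul]
    intro h
    apply hg'
    have h2 : k = k + (g' - g) := h.trans (by abel)
    exact sub_eq_zero.1 (left_eq_add.1 h2)
  · simp

lemma eq_of_mul_eq_left {b b' : B} {k : G} (hb : e k * ι b = e k * ι b') : b = b' :=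
  sub_eq_zero.1 (H.eq_zero_of_mul_eq_zero_left (k := k) (by simp [mul_sub, hb]))

/-- Averaging a `B`-linear map over the idempotents gives an `A`-linear map. -/
lemma exists_average {X Y : Type u} [AddCommGroup X] [AddCommGroup Y] [Module A X] [Module A Y]
    (f : X →+ Y) (hf : ∀ (b : B) x, f (ι b • x) = ι b • f x) :
    ∃ F : X →ₗ[A] Y, ∀ x, F x = ∑ h, e h • f (e h • x) := by
  let F : X →+ Y :=
    { toFun x := ∑ h, e h • f (e h • x)
      map_zero' := by simp
      map_add' := by simp [Finset.sum_add_distrib] }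
  have h1 (k : G) (x : X) : F (e k • x) = e k • F x := by
    simp only [F, AddMonoidHom.coe_mk, ZeroHom.coe_mk, Finset.smul_sum, smul_smul, H.mul_eq]
    refine Finset.sum_congr rfl fun h _ ↦ ?_
    by_cases hk : h = k
    · simp [hk]
    · simp [hk, Ne.symm hk]
  have h2 (b : B) (x : X) : F (ι b • x) = ι b • F x := by
    refine H.induction_left (P := fun b ↦ F (ι b • x) = ι b • F x) b (by simp) ?_ ?_
    · intro b b' hb hb'
      simp only [map_add, add_smul, hb, hb']
    · intro b g hb
      simp only [F, AddMonoidHom.coe_mk, ZeroHom.coe_mk, Finset.smul_sum, smul_smul]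
      -- A homogeneous b of degree g shifts the idempotents by g; reindexing the average absorbs the
      -- shift.
      rw [← Equiv.sum_comp (Equiv.addRight g)]
      refine Finset.sum_congr rfl fun h _ ↦ ?_
      simp only [Equiv.coe_addRight]
      rw [mul_eq_of_homogeneous hb, add_sub_cancel_right, mul_smul, hf, smul_smul, hb]
  refine ⟨{ F with map_smul' := fun a x ↦ ?_ }, fun x ↦ rfl⟩
  refine H.induction_on (P := fun a ↦ F (a • x) = a • F x) a (by simp) ?_ ?_
  · intro a a' ha ha'
    simp only [add_smul, map_add, ha, ha']
  · intro b g _ h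
    rw [mul_smul, h2, h1, smul_smul]

/-- A B-linear extension of an A-linear map is averaged to an A-linear one. It remains an extension,
since the average fixes A-linear maps: the e h are idempotents of sum 1. -/
lemma injective_of_restrictScalars (Y : ModuleCat.{u} A)
    (hY : Injective ((restrictScalars ι).obj Y)) : Injective Y where
  factors {X X'} g f hf := by
    have : Mono ((restrictScalars ι).map f) :=
      (ModuleCat.mono_iff_injective _).2 ((ModuleCat.mono_iff_injective f).1 hf)
    let k := Injective.factorThru ((restrictScalars ι).map g) ((restrictScalars ι).map f)
    have hk : (restrictScalars ι).map f ≫ k = (restrictScalars ι).map g :=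
      Injective.comp_factorThru _ _
    have hk' (x : X) : k.hom (f.hom x) = g.hom x := congr($(hk).hom x)
    let k' : X' →+ Y := ⟨⟨fun x ↦ k.hom x, k.hom.map_zero⟩, k.hom.map_add⟩
    have hk'' (x : X) : k' (f.hom x) = g.hom x := hk' x
    obtain ⟨F, hF⟩ := H.exists_average k' (fun b x ↦ k.hom.map_smul b x)
    refine ⟨ofHom F, ?_⟩
    ext x
    change F (f.hom x) = g.hom x
    rw [hF]
    have (h : G) : e h • k' (e h • f.hom x) = e h • g.hom x := by
      rw [← f.hom.map_smul, hk'', g.hom.map_smul, smul_smul, H.mul_self]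
    simp only [this, ← Finset.sum_smul, H.sum_eq_one, one_smul]

/-- The conceptual reason is that A is free on the e k as a right B-module, so that tensoring up is
exact. Concretely, a map from a left ideal I of B is extended to the left ideal J = ⊕ e_k ι(I) of A,
where Baer's criterion over A applies. -/
lemma injective_restrictScalars (Y : ModuleCat.{u} A) (hY : Injective Y) :
    Injective ((restrictScalars ι).obj Y) := by
  have hB : Module.Baer A Y :=
    Module.Baer.of_injective (Module.injective_module_of_injective_object A Y)
  suffices hB' : Module.Baer B ((restrictScalars ι).obj Y) from
    (Module.injective_iff_injective_object B ((restrictScalars ι).obj Y)).1 hB'.injective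
  intro I f
  let f' : I →+ Y := ⟨⟨fun i ↦ f i, f.map_zero⟩, f.map_add⟩
  have hf' (b : B) (i : I) : f' (b • i) = ι b • f' i := f.map_smul b i
  -- `Q a k i` says that i is the k-th coordinate of a in ⊕ e_k ι(I). The coordinate is unique by
  -- `eq_of_mul_eq_left`.
  let Q : A → G → I → Prop := fun a k i ↦ e k * a = e k * ι i
  have Q_e {a : A} {k : G} {i : I} (l : G) (h : Q a k i) :
      Q (e l * a) k (if k = l then i else 0) := by
    simp only [Q, ← mul_assoc, H.mul_eq] at h ⊢
    split_ifs with hkl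
    · rw [h]
    · simp
  have Q_hom {a : A} {k : G} {i : I} {b : B} {g : G} (hb : ∀ h, ι b * e h = e (h + g) * ι b)
      (h : Q a k i) : Q (ι b * a) (k + g) (b • i) := by
    simp only [Q] at h ⊢
    rw [← mul_assoc, mul_eq_of_homogeneous hb, add_sub_cancel_right, mul_assoc, h, ← mul_assoc,
      hb, mul_assoc, ← map_mul]
    rfl
  have Q_add {a a' : A} {k : G} {i i' : I} (h : Q a k i) (h' : Q a' k i') :
      Q (a + a') k (i + i') := by
    simp only [Q] at h h' ⊢
    simp [mul_add, h, h']
  have Q_unique {a : A} {k : G} {i i' : I} (h : Q a k i) (h' : Q a k i') : i = i' :=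
    Subtype.ext (H.eq_of_mul_eq_left (h.symm.trans h'))
  let J : Submodule A A :=
    { carrier := {a | ∀ k, ∃ i, Q a k i}
      add_mem' := fun {a a'} h h' k ↦
        ⟨_, Q_add (h k).choose_spec (h' k).choose_spec⟩
      zero_mem' := fun k ↦ ⟨0, by simp [Q]⟩
      smul_mem' := fun a x hx ↦ by
        refine H.induction_on (P := fun a ↦ ∀ k, ∃ i, Q (a * x) k i) a
          (fun k ↦ ⟨0, by simp [Q]⟩) ?_ ?_
        · intro a a' h h' k
          rw [add_mul]
          exact ⟨_, Q_add (h k).choose_spec (h' k).choose_spec⟩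
        · intro b g hb h k
          rw [mul_assoc]
          have := Q_hom hb (Q_e h (hx (k - g)).choose_spec)
          rw [sub_add_cancel] at this
          exact ⟨_, this⟩ }
  let i : J → G → I := fun a k ↦ (a.2 k).choose
  have hi (a : J) (k : G) : Q a k (i a k) := (a.2 k).choose_spec
  have i_add (a a' : J) (k : G) : i (a + a') k = i a k + i a' k :=
    Q_unique (hi _ k) (Q_add (hi a k) (hi a' k))
  let F : J →+ Y := AddMonoidHom.mk' (fun a ↦ ∑ k, e k • f' (i a k)) fun a a' ↦ by
    simp [i_add, Finset.sum_add_distrib]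
  have F_e (l : G) (a : J) : F (e l • a) = e l • F a := by
    have (k : G) : i (e l • a) k = if k = l then i a k else 0 :=
      Q_unique (hi _ k) (Q_e l (hi a k))
    simp only [F, AddMonoidHom.mk'_apply, Finset.smul_sum, smul_smul, H.mul_eq, this]
    refine Finset.sum_congr rfl fun k _ ↦ ?_
    by_cases hk : k = l
    · simp [hk]
    · simp [hk, Ne.symm hk]
  have F_b (b : B) (a : J) : F (ι b • a) = ι b • F a := by
    refine H.induction_left (P := fun b ↦ F (ι b • a) = ι b • F a) b (by simp) ?_ ?_
    · intro b b' hb hb'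
      simp only [map_add, add_smul, hb, hb']
    · intro b g hb
      have (k : G) : i (ι b • a) (k + g) = b • i a k := Q_unique (hi _ _) (Q_hom hb (hi a k))
      simp only [F, AddMonoidHom.mk'_apply, Finset.smul_sum, smul_smul]
      rw [← Equiv.sum_comp (Equiv.addRight g)]
      refine Finset.sum_congr rfl fun k _ ↦ ?_
      simp only [Equiv.coe_addRight]
      rw [this, hf', smul_smul, hb]
  obtain ⟨F', hF'⟩ := hB J { F with
    map_smul' := fun a x ↦ by
      refine H.induction_on (P := fun a ↦ F (a • x) = a • F x) a (by simp) ?_ ?_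
      · intro a a' ha ha'
        simp only [add_smul, map_add, ha, ha']
      · intro b g _ h
        rw [mul_smul, F_b, F_e, smul_smul] }
  -- For x in I every coordinate of ι x is x itself, so the extended map sends ι x to the sum of the
  -- e k • f x, which is f x.
  refine ⟨(LinearMap.toSpanSingleton B ((restrictScalars ι).obj Y) (F' 1 : Y)), fun x hx ↦ ?_⟩
  change ι x • F' 1 = f' ⟨x, hx⟩
  rw [← map_smul, smul_eq_mul, mul_one]
  have hxJ : ι x ∈ J := fun k ↦ ⟨⟨x, hx⟩, rfl⟩
  have hix (k : G) : i ⟨ι x, hxJ⟩ k = ⟨x, hx⟩ := Q_unique (hi ⟨ι x, hxJ⟩ k) rfl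
  refine (hF' _ hxJ).trans ?_
  change ∑ k, e k • f' (i ⟨ι x, hxJ⟩ k) = _
  simp only [hix, ← Finset.sum_smul, H.sum_eq_one, one_smul]

lemma hasInjectiveDimensionLE_restrictScalars (n : ℕ) (Y : ModuleCat.{u} A)
    (hY : HasInjectiveDimensionLE Y n) :
    HasInjectiveDimensionLE ((restrictScalars ι).obj Y) n :=
  hasInjectiveDimensionLE_obj (restrictScalars ι).obj (exists_shortExact_restrictScalars ι)
    H.injective_restrictScalars n Y hY

lemma hasInjectiveDimensionLE_of_restrictScalars (n : ℕ) (Y : ModuleCat.{u} A)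
    (hY : HasInjectiveDimensionLE ((restrictScalars ι).obj Y) n) :
    HasInjectiveDimensionLE Y n :=
  hasInjectiveDimensionLE_of_obj (ι := Unit) (fun _ ↦ (restrictScalars ι).obj)
    (fun _ ↦ exists_shortExact_restrictScalars ι)
    (fun _ ↦ H.injective_restrictScalars) (fun I hI ↦ H.injective_of_restrictScalars I (hI ()))
    n Y fun _ ↦ hY

lemma globalDim_le (n : ℕ) (h : ∀ Y : ModuleCat.{u} B, HasInjectiveDimensionLE Y n)
    (Y : ModuleCat.{u} A) : HasInjectiveDimensionLE Y n :=
  H.hasInjectiveDimensionLE_of_restrictScalars n Y (h _)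

/-- The coordinates with respect to the basis `e` of the left `B`-module `A`. -/
noncomputable def coordEquiv : (G → B) ≃ₗ[B] (restrictScalars ι).obj (of A A) :=
  let f : (G → B) →ₗ[B] (restrictScalars ι).obj (of A A) :=
    { toFun := fun b ↦ (∑ h, ι (b h) * e h : A)
      map_add' := fun b b' ↦ by
        simp only [Pi.add_apply, map_add, add_mul, Finset.sum_add_distrib]; rfl
      map_smul' := fun c b ↦ by
        change _ = ι c * ∑ h, ι (b h) * e h
        simp [Finset.mul_sum, mul_assoc] }
  LinearEquiv.ofBijective f H.bijective

lemma coordEquiv_single (h : G) (b : B) :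
    H.coordEquiv (Pi.single h b) = (ι b * e h : A) := by
  refine (Finset.sum_eq_single (M := A) h ?_ ?_).trans ?_ <;> simp +contextual

lemma hasInjectiveDimensionLE_self (n : ℕ) (h : HasInjectiveDimensionLE (of B B) n) :
    HasInjectiveDimensionLE (of A A) n := by
  apply H.hasInjectiveDimensionLE_of_restrictScalars
  have h1 := hasInjectiveDimensionLE_pi n h (Fintype.card G)
  let E : (Fin (Fintype.card G) → B) ≃ₗ[B] (restrictScalars ι).obj (of A A) :=
    (LinearEquiv.funCongrLeft B B (Fintype.equivFin G)).trans H.coordEquiv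
  exact hasInjectiveDimensionLT_of_iso E.toModuleIso _

/-- The map b ↦ ι b * e 0 embeds B in A as a direct summand of left B-modules. -/
lemma hasInjectiveDimensionLE_self_left (n : ℕ) (h : HasInjectiveDimensionLE (of A A) n) :
    HasInjectiveDimensionLE (of B B) n := by
  have h1 := H.hasInjectiveDimensionLE_restrictScalars n _ h
  let i : B →ₗ[B] (restrictScalars ι).obj (of A A) :=
    H.coordEquiv.toLinearMap ∘ₗ LinearMap.single B (fun _ ↦ B) (0 : G)
  let p : (restrictScalars ι).obj (of A A) →ₗ[B] B :=
    LinearMap.proj (0 : G) ∘ₗ H.coordEquiv.symm.toLinearMap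
  have hpi : p ∘ₗ i = LinearMap.id := by
    ext
    simp only [p, i, LinearMap.comp_apply, LinearEquiv.coe_coe, LinearEquiv.symm_apply_apply]
    simp
  let r : Retract (of B B) ((restrictScalars ι).obj (of A A)) :=
    { i := (ofHom i : of B B ⟶ of B ((restrictScalars ι).obj (of A A)))
      r := (ofHom p : of B ((restrictScalars ι).obj (of A A)) ⟶ of B B)
      retract := congrArg ofHom hpi }
  exact r.hasInjectiveDimensionLT _

/-- The map τ(ι b * e k) = |G|⁻¹ b is a B-bimodule retraction of A onto B. Hence x ↦ (a ↦ τ(a) x)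
and evaluation at 1 exhibit X as a retract of Hom_B(A, X), which is restricted from A. -/
lemma globalDim_le_left (hG : IsUnit (Fintype.card G : B)) (n : ℕ)
    (h : ∀ Y : ModuleCat.{u} A, HasInjectiveDimensionLE Y n) (X : ModuleCat.{u} B) :
    HasInjectiveDimensionLE X n := by
  have h1 := H.hasInjectiveDimensionLE_restrictScalars n _ (h ((coextendScalars ι).obj X))
  obtain ⟨u, hu⟩ := hG
  have hu' (b : B) : b * (↑u⁻¹ : B) = ↑u⁻¹ * b := by
    have : Commute b (u : B) := by rw [hu]; exact (Nat.cast_commute _ b).symm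
    exact this.units_inv_right
  let τ : (restrictScalars ι).obj (of A A) →ₗ[B] B :=
    (LinearMap.toSpanSingleton B B (↑u⁻¹ : B)) ∘ₗ (∑ k, LinearMap.proj (R := B) (φ := fun _ ↦ B) k)
      ∘ₗ H.coordEquiv.symm.toLinearMap
  have τ_single (b : B) (k : G) : τ (ι b * e k : A) = ↑u⁻¹ * b := by
    rw [← H.coordEquiv_single]
    simp only [τ, LinearMap.comp_apply, LinearEquiv.coe_coe, LinearEquiv.symm_apply_apply,
      LinearMap.toSpanSingleton_apply, smul_eq_mul, LinearMap.sum_apply, LinearMap.proj_apply,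
      ← hu']
    simp
  have τ_one : τ (1 : A) = 1 := by
    have (k : G) : (e k : A) = ι 1 * e k := by simp
    rw [← H.sum_eq_one]
    refine (map_sum τ _ _).trans ?_
    calc ∑ k, τ (e k : A) = ∑ k : G, (↑u⁻¹ : B) :=
          Finset.sum_congr rfl fun k _ ↦ by rw [this k, τ_single, mul_one]
      _ = 1 := by rw [Finset.sum_const, nsmul_eq_mul, Finset.card_univ, ← hu, Units.mul_inv]
  -- Moving a homogeneous b to the left past `e k` only changes which idempotent occurs, and τ gives
  -- all of them equal weight.
  have τ_mul (a : A) (b : B) : τ (a * ι b : A) = τ (a : A) * b := by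
    refine H.induction_left (P := fun b ↦ τ (a * ι b : A) = τ (a : A) * b) b
      (by rw [map_zero, mul_zero, mul_zero]; exact map_zero τ) ?_ ?_
    · intro b b' h h'
      rw [map_add, mul_add, mul_add, ← h, ← h']
      exact map_add τ _ _
    intro b g hb
    refine H.induction_on (P := fun a ↦ τ (a * ι b : A) = τ (a : A) * b) a ?_ ?_ ?_
    · rw [zero_mul]
      refine (map_zero τ).trans ?_
      exact ((congrArg (· * b) (map_zero τ)).trans (zero_mul b)).symm
    · intro a a' h h'
      rw [add_mul]
      refine (map_add τ _ _).trans ?_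
      rw [h, h']
      exact ((congrArg (· * b) (map_add τ a a')).trans (add_mul _ _ _)).symm
    · intro b' _ _ k
      rw [τ_single, mul_assoc, mul_eq_of_homogeneous hb, ← mul_assoc, ← map_mul, τ_single,
        mul_assoc]
  let Z := (restrictScalars ι).obj ((coextendScalars ι).obj X)
  let i : X →ₗ[B] Z :=
    { toFun := fun x ↦ (CoextendScalars.equiv ι X).symm ((LinearMap.toSpanSingleton B X x) ∘ₗ τ)
      map_add' := fun x y ↦ by
        rw [LinearMap.toSpanSingleton_add, LinearMap.add_comp, map_add]; rfl
      map_smul' := fun b x ↦ by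
        refine CoextendScalars.ext (LinearMap.ext fun (a : A) ↦ ?_)
        change τ (a : A) • b • x = τ (a * ι b : A) • x
        rw [τ_mul, mul_smul] }
  let p : Z →ₗ[B] X :=
    { toFun := fun f ↦ CoextendScalars.equiv ι X f (1 : A)
      map_add' := fun f g ↦ rfl
      map_smul' := fun b f ↦ by
        change CoextendScalars.equiv ι X f (1 * ι b : A) = _
        rw [one_mul, ← mul_one (ι b)]
        exact (CoextendScalars.equiv ι X f).map_smul b (1 : A) }
  let r : Retract X Z :=
    { i := (ofHom i : of B X ⟶ of B Z)
      r := (ofHom p : of B Z ⟶ of B X)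
      retract := by
        ext x
        change τ (1 : A) • x = x
        rw [τ_one, one_smul] }
  exact r.hasInjectiveDimensionLT _

end IsSmashExtension

/-! ### Modules over localizations at central elements -/

section CentralLocalization

variable {C : Type u} [CommRing C] (W : Submonoid C) {Λ Λ' : Type u} [Ring Λ] [Ring Λ']
  [Algebra C Λ] [Algebra C Λ'] (α : Λ →ₐ[C] Λ') [IsLocalizedModule W α.toLinearMap]

include α in
lemma isUnit_algebraMap_of_isLocalizedModule (w : W) : IsUnit (algebraMap C Λ' w) := by
  obtain ⟨v, hv⟩ := ((Module.End.isUnit_iff _).1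
    (IsLocalizedModule.map_units α.toLinearMap w)).2 (1 : Λ')
  have hv' : algebraMap C Λ' w * v = 1 := by
    rw [← hv, Module.algebraMap_end_apply, Algebra.smul_def]
  refine ⟨⟨_, v, hv', ?_⟩, rfl⟩
  rw [← Algebra.commutes, hv']

include α in
lemma isUnit_algebraMap_end_of_isLocalizedModule {Y : Type*} [AddCommGroup Y] [Module C Y]
    [Module Λ' Y] [IsScalarTower C Λ' Y] (w : W) :
    IsUnit (algebraMap C (Module.End C Y) w) := by
  have : algebraMap C (Module.End C Y) w =
      Algebra.lsmul C C Y (algebraMap C Λ' w) := by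
    ext y
    simp [Module.algebraMap_end_apply]
  rw [this]
  exact (isUnit_algebraMap_of_isLocalizedModule W α w).map (Algebra.lsmul C C Y)

include W in
/-- Additive maps that are linear over a ring are linear over its central localizations. -/
lemma map_smul_of_isLocalizedModule {X Y : Type*} [AddCommGroup X] [AddCommGroup Y] [Module Λ' X]
    [Module Λ' Y] (f : X →+ Y) (hf : ∀ l x, f (α l • x) = α l • f x) (l : Λ') (x : X) :
    f (l • x) = l • f x := by
  obtain ⟨⟨l', w⟩, h⟩ := IsLocalizedModule.surj W α.toLinearMap l
  have h' : algebraMap C Λ' w * l = α l' := by rw [← Algebra.smul_def]; exact h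
  obtain ⟨u, hu⟩ := isUnit_algebraMap_of_isLocalizedModule W α w
  have hc (z : X) : f ((u : Λ') • z) = (u : Λ') • f z := by
    rw [hu, ← AlgHom.commutes α, hf]
  have : (u : Λ') • f (l • x) = (u : Λ') • l • f x := by
    rw [← hc, smul_smul, smul_smul, hu, h', hf]
  have := congrArg (fun z ↦ (↑u⁻¹ : Λ') • z) this
  simpa [smul_smul] using this

section Module

variable (X : Type u) [AddCommGroup X] [Module C X] [Module Λ X] [IsScalarTower C Λ X]

/-- The action of `Λ` on the localization of a `Λ`-module at central elements. -/
noncomputable def localizedActionAux : Λ →ₗ[C] Module.End C (LocalizedModule W X) :=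
  IsLocalizedModule.map W (LocalizedModule.mkLinearMap W X) (LocalizedModule.mkLinearMap W X) ∘ₗ
    (Algebra.lsmul C C X).toLinearMap

lemma localizedActionAux_mul (a b : Λ) : localizedActionAux W X (a * b) =
    localizedActionAux W X a * localizedActionAux W X b := by
  simp only [localizedActionAux, LinearMap.comp_apply, AlgHom.toLinearMap_apply, map_mul]
  exact IsLocalizedModule.map_comp' W _ (LocalizedModule.mkLinearMap W X) _ _ _

lemma localizedActionAux_one : localizedActionAux (Λ := Λ) W X 1 = 1 := by
  simp only [localizedActionAux, LinearMap.comp_apply, AlgHom.toLinearMap_apply, map_one]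
  exact IsLocalizedModule.map_id W _

/-- The action of a central localization `Λ'` of `Λ` on the localization of a `Λ`-module. -/
noncomputable def localizedAction : Λ' →ₗ[C] Module.End C (LocalizedModule W X) :=
  IsLocalizedModule.lift W α.toLinearMap (localizedActionAux W X) fun w ↦ by
    have h := IsLocalizedModule.map_units (LocalizedModule.mkLinearMap W X) w
    have : algebraMap C (Module.End C (Module.End C (LocalizedModule W X))) w =
        Algebra.lmul C _ (algebraMap C (Module.End C (LocalizedModule W X)) w) := by
      ext f
      simp [Algebra.smul_def, Module.algebraMap_end_apply]
    rw [this]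
    exact h.map (Algebra.lmul C (Module.End C (LocalizedModule W X)))

lemma localizedAction_apply (l : Λ) :
    localizedAction W α X (α l) = localizedActionAux W X l :=
  IsLocalizedModule.lift_apply W α.toLinearMap _ _ l

lemma localizedAction_one : localizedAction W α X 1 = 1 := by
  rw [← map_one α, localizedAction_apply, localizedActionAux_one]

/-- After multiplication by denominators of a and b both sides come from Λ, where multiplicativity
is known; denominators act injectively, so they cancel. -/
lemma localizedAction_mul (a b : Λ') : localizedAction W α X (a * b) =
    localizedAction W α X a * localizedAction W α X b := by
  have hu (w : W) : Function.Injective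
      (fun f : Module.End C (LocalizedModule W X) ↦ (w : C) • f) := by
    intro f g hfg
    ext x
    have := congr($hfg x)
    exact ((Module.End.isUnit_iff _).1
      (IsLocalizedModule.map_units (LocalizedModule.mkLinearMap W X) w)).1 this
  obtain ⟨⟨a', s⟩, ha⟩ := IsLocalizedModule.surj W α.toLinearMap a
  obtain ⟨⟨b', t⟩, hb⟩ := IsLocalizedModule.surj W α.toLinearMap b
  replace ha : (s : C) • a = α a' := ha
  replace hb : (t : C) • b = α b' := hb
  apply hu s
  apply hu t
  simp only
  rw [← map_smul, ← map_smul, ← smul_mul_assoc, ha, ← mul_smul_comm, hb, ← map_mul,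
    localizedAction_apply, localizedActionAux_mul, ← localizedAction_apply W α,
    ← localizedAction_apply W α, ← ha, ← hb, map_smul, map_smul, smul_mul_smul_comm, smul_smul,
    mul_comm]

/-- The module structure over a central localization `Λ'` of `Λ` on the localization of a
`Λ`-module. -/
noncomputable abbrev localizedModuleModule : Module Λ' (LocalizedModule W X) :=
  Module.compHom _
    ({ toFun := localizedAction W α X
       map_one' := localizedAction_one W α X
       map_mul' := localizedAction_mul W α X
       map_zero' := map_zero _
       map_add' := map_add _ } : Λ' →+* Module.End C (LocalizedModule W X))

/-- The localization of a `Λ`-module at central elements, as a module over the localization `Λ'`. -/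
noncomputable def localizedModuleCat : ModuleCat.{u} Λ' :=
  letI := localizedModuleModule W α X
  ModuleCat.of Λ' (LocalizedModule W X)

noncomputable instance : Module C (localizedModuleCat W α X) :=
  inferInstanceAs (Module C (LocalizedModule W X))

instance : IsScalarTower C Λ' (localizedModuleCat W α X) where
  smul_assoc c l x := by
    exact LinearMap.congr_fun (map_smul (localizedAction W α X) c l) x

/-- The localization map, as a linear map over the base. -/
noncomputable def localizedModuleCatMk : X →ₗ[C] localizedModuleCat W α X :=
  LocalizedModule.mkLinearMap W X

instance : IsLocalizedModule W (localizedModuleCatMk W α X) :=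
  inferInstanceAs (IsLocalizedModule W (LocalizedModule.mkLinearMap W X))

lemma localizedModuleCatMk_smul (l : Λ) (x : X) :
    localizedModuleCatMk W α X (l • x) = α l • localizedModuleCatMk W α X x := by
  change _ = localizedAction W α X (α l) (LocalizedModule.mkLinearMap W X x)
  rw [localizedAction_apply]
  exact (IsLocalizedModule.map_apply W (LocalizedModule.mkLinearMap W X)
    (LocalizedModule.mkLinearMap W X) (Algebra.lsmul C C X l) x).symm

end Module

section Lift

variable {X X' Y' : Type u} [AddCommGroup X] [Module C X] [Module Λ X] [IsScalarTower C Λ X]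
  [AddCommGroup X'] [Module C X'] [Module Λ' X'] [IsScalarTower C Λ' X']
  [AddCommGroup Y'] [Module C Y'] [Module Λ' Y'] [IsScalarTower C Λ' Y']

omit [IsScalarTower C Λ X] in
include α in
/-- A `Λ`-linear map to a module over the localization extends to the localization. -/
lemma exists_lift_of_isLocalizedModule (j : X →ₗ[C] X') [IsLocalizedModule W j]
    (hj : ∀ (l : Λ) x, j (l • x) = α l • j x) (f : X →ₗ[C] Y')
    (hf : ∀ (l : Λ) x, f (l • x) = α l • f x) :
    ∃ F : X' →ₗ[Λ'] Y', (∀ x, F (j x) = f x) ∧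
      ((∀ x, f x = 0 → j x = 0) → Function.Injective F) := by
  have hu := isUnit_algebraMap_end_of_isLocalizedModule (Y := Y') W α
  let F := IsLocalizedModule.lift W j f hu
  have hF (x : X) : F (j x) = f x := IsLocalizedModule.lift_apply W j f hu x
  have hlin (l : Λ) (x : X') : F (α l • x) = α l • F x := by
    obtain ⟨⟨x', w⟩, h⟩ := IsLocalizedModule.surj W j x
    replace h : (w : C) • x = j x' := h
    have h1 : (w : C) • F (α l • x) = (w : C) • (α l • F x) := by
      rw [← map_smul, smul_comm, h, ← hj, hF, hf, ← hF, ← h, map_smul, smul_comm]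
    exact ((Module.End.isUnit_iff _).1 (hu w)).1 h1
  refine ⟨{ F with
    map_smul' := map_smul_of_isLocalizedModule W α F.toAddMonoidHom hlin }, hF, fun hinj ↦ ?_⟩
  rw [injective_iff_map_eq_zero]
  intro x hx
  obtain ⟨⟨x', w⟩, h⟩ := IsLocalizedModule.surj W j x
  replace h : (w : C) • x = j x' := h
  replace hx : F x = 0 := hx
  have : f x' = 0 := by rw [← hF, ← h, map_smul, hx, smul_zero]
  rw [hinj x' this] at h
  exact ((Module.End.isUnit_iff _).1 (IsLocalizedModule.map_units j w)).1
    (h.trans (smul_zero _).symm)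

end Lift

end CentralLocalization

/-! ### Clearing denominators of maps -/

section Denominators

variable {C : Type u} [CommRing C] (W : Submonoid C) {Λ : Type u} [Ring Λ] [Algebra C Λ]

lemma exists_common_multiple {ι : Type*} [Finite ι] (P : ι → C → Prop)
    (hP : ∀ i c d, P i c → P i (d * c)) (h : ∀ i, ∃ w ∈ W, P i w) : ∃ w ∈ W, ∀ i, P i w := by
  cases nonempty_fintype ι
  choose w hw hPw using h
  refine ⟨∏ i, w i, W.prod_mem fun i _ ↦ hw i, fun i ↦ ?_⟩
  obtain ⟨d, hd⟩ := Finset.dvd_prod_of_mem w (Finset.mem_univ i)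
  rw [hd, mul_comm]
  exact hP _ _ _ (hPw i)

lemma exists_smul_eq_zero_of_fg {X Y : Type*} [AddCommGroup X] [AddCommGroup Y] [Module Λ X]
    [Module C Y] [Module Λ Y] [IsScalarTower C Λ Y] (g : X →ₗ[Λ] Y) (K : Submodule Λ X)
    (hK : K.FG) (h : ∀ k ∈ K, ∃ w ∈ W, w • g k = 0) : ∃ w ∈ W, ∀ k ∈ K, w • g k = 0 := by
  obtain ⟨t, rfl⟩ := hK
  obtain ⟨w, hw, hw'⟩ := exists_common_multiple W (ι := t) (fun k c ↦ c • g k = 0)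
    (fun i c d hc ↦ by rw [mul_smul, hc, smul_zero])
    (fun k ↦ h k (Submodule.subset_span k.2))
  refine ⟨w, hw, fun k hk ↦ ?_⟩
  have : Submodule.span Λ (t : Set X) ≤ LinearMap.ker (w • g) :=
    Submodule.span_le.2 fun k hk ↦ hw' ⟨k, hk⟩
  exact this hk

/-- Up to multiplication by a denominator, maps from a finitely generated left ideal of a
noetherian ring to a localized module come from maps to the module itself. -/
lemma exists_numerator [IsNoetherianRing Λ] {Y Y' : Type u} [AddCommGroup Y] [Module C Y]
    [Module Λ Y] [IsScalarTower C Λ Y] [AddCommGroup Y'] [Module C Y'] [Module Λ Y']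
    [IsScalarTower C Λ Y'] (j : Y →ₗ[Λ] Y')
    [IsLocalizedModule W (j.restrictScalars C)] (I : Ideal Λ) (f : I →ₗ[Λ] Y') :
    ∃ w ∈ W, ∃ g : I →ₗ[Λ] Y, ∀ x, j (g x) = w • f x := by
  obtain ⟨n, π, hπ⟩ := Module.Finite.exists_fin' Λ I
  obtain ⟨w, hw, hw'⟩ := exists_common_multiple W (ι := Fin n)
    (fun i c ↦ ∃ y : Y, j y = c • f (π (Pi.single i 1)))
    (fun i c d ⟨y, hy⟩ ↦ ⟨d • y, by rw [mul_smul, ← hy]; exact (j.restrictScalars C).map_smul d y⟩)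
    (fun i ↦ by
      obtain ⟨⟨y, w⟩, h⟩ := IsLocalizedModule.surj W (j.restrictScalars C) (f (π (Pi.single i 1)))
      exact ⟨w, w.2, y, h.symm⟩)
  choose y hy using hw'
  let g : (Fin n → Λ) →ₗ[Λ] Y := (Pi.basisFun Λ (Fin n)).constr ℕ y
  have hg : j ∘ₗ g = w • (f ∘ₗ π) := by
    refine (Pi.basisFun Λ (Fin n)).ext fun i ↦ ?_
    change j (g _) = w • f (π _)
    rw [Module.Basis.constr_basis, hy, Pi.basisFun_apply]
  -- The lift g to the free module kills the relations only after localization. They are finitely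
  -- generated, so a single further denominator v makes v • g descend to I.
  obtain ⟨v, hv, hv'⟩ := exists_smul_eq_zero_of_fg W g (LinearMap.ker π)
    (IsNoetherian.noetherian _) (fun k hk ↦ by
      have : j (g k) = 0 := by
        have := congr($hg k)
        simpa [LinearMap.mem_ker.1 hk] using this
      obtain ⟨c, hc⟩ := (IsLocalizedModule.eq_zero_iff W (j.restrictScalars C)).1 this
      exact ⟨c, c.2, hc⟩)
  let e := π.quotKerEquivOfSurjective hπ
  refine ⟨v * w, W.mul_mem hv hw,
    (LinearMap.ker π).liftQ (v • g) (fun k hk ↦ hv' k hk) ∘ₗ e.symm.toLinearMap, fun x ↦ ?_⟩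
  obtain ⟨z, rfl⟩ := hπ x
  have : e.symm (π z) = Submodule.Quotient.mk z := by
    rw [LinearEquiv.symm_apply_eq]; rfl
  rw [LinearMap.comp_apply, LinearEquiv.coe_coe, this, mul_smul]
  have h2 := congr($hg z)
  change j (g z) = w • f (π z) at h2
  rw [← h2]
  exact (j.restrictScalars C).map_smul v _

end Denominators

/-! ### Injectivity is a local property over noetherian rings -/

section InjectiveLocalization

variable {C : Type u} [CommRing C] (W : Submonoid C) {Λ Λ' : Type u} [Ring Λ] [Ring Λ']
  [Algebra C Λ] [Algebra C Λ'] (α : Λ →ₐ[C] Λ') [IsLocalizedModule W α.toLinearMap]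

lemma isScalarTower_compHom_algHom {Y' : Type*} [AddCommGroup Y'] [Module C Y'] [Module Λ' Y']
    [IsScalarTower C Λ' Y'] :
    let : Module Λ Y' := Module.compHom Y' α.toRingHom
    IsScalarTower C Λ Y' := by
  let : Module Λ Y' := Module.compHom Y' α.toRingHom
  refine ⟨fun c l y ↦ ?_⟩
  change α (c • l) • y = c • α l • y
  rw [map_smul, smul_assoc]

include W in
/-- Over a noetherian ring, localizations of injective modules at central elements are injective. -/
lemma baer_of_isLocalizedModule [IsNoetherianRing Λ] {Y Y' : Type u} [AddCommGroup Y] [Module C Y]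
    [Module Λ Y] [IsScalarTower C Λ Y] [AddCommGroup Y'] [Module C Y'] [Module Λ' Y']
    [IsScalarTower C Λ' Y'] (j : Y →ₗ[C] Y') [IsLocalizedModule W j]
    (hj : ∀ (l : Λ) y, j (l • y) = α l • j y) (hY : Module.Baer Λ Y) : Module.Baer Λ' Y' := by
  intro I' f
  let : Module Λ Y' := Module.compHom Y' α.toRingHom
  have : IsScalarTower C Λ Y' := isScalarTower_compHom_algHom α
  let I : Ideal Λ := I'.comap α.toRingHom
  let f₀ : I →ₗ[Λ] Y' :=
    { toFun := fun x ↦ f ⟨α x, x.2⟩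
      map_add' := fun x y ↦ by rw [← map_add]; congr 1; exact Subtype.ext (map_add α _ _)
      map_smul' := fun l x ↦ by
        change _ = α l • f ⟨α x, x.2⟩
        rw [← f.map_smul]; congr 1; exact Subtype.ext (map_mul α _ _) }
  let j' : Y →ₗ[Λ] Y' := { j with map_smul' := hj }
  have : IsLocalizedModule W (j'.restrictScalars C) := ‹IsLocalizedModule W j›
  obtain ⟨w, hw, g, hg⟩ := exists_numerator W j' I f₀
  obtain ⟨g', hg'⟩ := hY I g
  have hunit := isUnit_algebraMap_end_of_isLocalizedModule (Y := Y') W α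
  -- The map w • f extends with value j (g' 1) at 1; dividing by the denominator w gives the value
  -- for f.
  obtain ⟨z, hz⟩ := ((Module.End.isUnit_iff _).1 (hunit ⟨w, hw⟩)).2 (j (g' 1))
  replace hz : w • z = j (g' 1) := hz
  refine ⟨LinearMap.toSpanSingleton Λ' Y' z, fun x hx ↦ ?_⟩
  rw [LinearMap.toSpanSingleton_apply]
  obtain ⟨⟨l, v⟩, h⟩ := IsLocalizedModule.surj W α.toLinearMap x
  replace h : (v : C) • x = α l := h
  have hl : l ∈ I := by
    change α l ∈ I'
    rw [← h, Algebra.smul_def]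
    exact I'.mul_mem_left _ hx
  apply ((Module.End.isUnit_iff _).1 (hunit v)).1
  apply ((Module.End.isUnit_iff _).1 (hunit ⟨w, hw⟩)).1
  change w • (v : C) • x • z = w • (v : C) • f ⟨x, hx⟩
  have h1 : (v : C) • f ⟨x, hx⟩ = f₀ ⟨l, hl⟩ := by
    change _ = f ⟨α l, hl⟩
    rw [← f.map_smul_of_tower]
    congr 1
    exact Subtype.ext h
  rw [h1, ← hg, ← smul_assoc (v : C) x z, h, smul_comm, hz]
  change _ = j (g ⟨l, hl⟩)
  rw [← hg', ← hj, ← map_smul, smul_eq_mul, mul_one]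

/-- A module over a noetherian ring is injective if sufficiently many of its localizations at
central elements are. -/
lemma baer_of_forall_isLocalizedModule [IsNoetherianRing Λ] {ι : Type*} (W : ι → Submonoid C)
    (Λ' : ι → Type u) [∀ i, Ring (Λ' i)] [∀ i, Algebra C (Λ' i)] (α : ∀ i, Λ →ₐ[C] Λ' i)
    [∀ i, IsLocalizedModule (W i) (α i).toLinearMap]
    (hW : ∀ J : Ideal C, (∀ i, ∃ w ∈ W i, w ∈ J) → ∃ u ∈ J, IsUnit (algebraMap C Λ u))
    (Y : Type u) [AddCommGroup Y] [Module C Y] [Module Λ Y] [IsScalarTower C Λ Y]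
    (hY : ∀ i, Module.Baer (Λ' i) (localizedModuleCat (W i) (α i) Y)) : Module.Baer Λ Y := by
  intro I f
  -- J consists of the scalars c for which c • f extends to Λ. It is enough to find in it an element
  -- that is a unit of Λ.
  let J : Ideal C :=
    { carrier := {c | ∃ y : Y, ∀ x : I, (x : Λ) • y = c • f x}
      zero_mem' := ⟨0, fun x ↦ by simp⟩
      add_mem' := by
        rintro c d ⟨y, hy⟩ ⟨z, hz⟩
        exact ⟨y + z, fun x ↦ by rw [smul_add, hy, hz, add_smul]⟩
      smul_mem' := by
        rintro c d ⟨y, hy⟩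
        exact ⟨c • y, fun x ↦ by rw [smul_comm, hy, smul_eq_mul, mul_smul]⟩ }
  obtain ⟨u, ⟨y, hy⟩, hu⟩ := hW J fun i ↦ by
    let j := localizedModuleCatMk (W i) (α i) Y
    have hj := localizedModuleCatMk_smul (W i) (α i) Y
    obtain ⟨F, hF, -⟩ := exists_lift_of_isLocalizedModule (W i) (α i)
      (localizedModuleCatMk (W i) (α i) I) (localizedModuleCatMk_smul (W i) (α i) I)
      (j ∘ₗ f.restrictScalars C) (fun l x ↦ (congrArg j (f.map_smul l x)).trans (hj l (f x)))
    -- E embeds the localized ideal in Λ', so that injectivity of the localized module extends the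
    -- localized f along it.
    obtain ⟨E, hE, hE'⟩ := exists_lift_of_isLocalizedModule (W i) (α i)
      (localizedModuleCatMk (W i) (α i) I) (localizedModuleCatMk_smul (W i) (α i) I)
      ((α i).toLinearMap ∘ₗ I.subtype.restrictScalars C) (fun l x ↦ map_mul (α i) _ _)
    have hEinj : Function.Injective E := hE' fun x hx ↦ by
      obtain ⟨c, hc⟩ := (IsLocalizedModule.eq_zero_iff (W i) (α i).toLinearMap).1 hx
      refine (IsLocalizedModule.eq_zero_iff (W i) _).2 ⟨c, Subtype.ext hc⟩
    obtain ⟨h, hh⟩ := (hY i).extension_property E hEinj F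
    have hz (x : I) : α i x • h 1 = j (f x) := by
      rw [← map_smul, smul_eq_mul, mul_one]
      have h1 := hE x
      change _ = α i x at h1
      rw [← h1]
      exact congr($hh (localizedModuleCatMk (W i) (α i) I x)).trans (hF x)
    obtain ⟨⟨y, w⟩, hy⟩ := IsLocalizedModule.surj (W i) j (h 1)
    replace hy : (w : C) • h 1 = j y := hy
    -- g measures the failure of y to extend w • f. It vanishes after localization, and I is
    -- finitely generated, so one denominator w' kills it.
    let g : I →ₗ[Λ] Y := LinearMap.toSpanSingleton Λ Y y ∘ₗ I.subtype - (w : C) • f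
    obtain ⟨w', hw', h'⟩ := exists_smul_eq_zero_of_fg (W i) g ⊤ (IsNoetherian.noetherian _)
      fun x _ ↦ by
        have : j (g x) = 0 := by
          change j ((x : Λ) • y - (w : C) • f x) = 0
          rw [map_sub, hj, ← hy, map_smul, ← hz, smul_comm, sub_self]
        obtain ⟨c, hc⟩ := (IsLocalizedModule.eq_zero_iff (W i) j).1 this
        exact ⟨c, c.2, hc⟩
    refine ⟨w' * w, (W i).mul_mem hw' w.2, w' • y, fun x ↦ ?_⟩
    have := h' x trivial
    change w' • ((x : Λ) • y - (w : C) • f x) = 0 at this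
    rw [smul_sub, sub_eq_zero] at this
    rw [smul_comm, this, mul_smul]
  obtain ⟨v, hv⟩ := hu
  have hc (l : Λ) : l * (↑v⁻¹ : Λ) = ↑v⁻¹ * l := by
    have : Commute l (v : Λ) := by rw [hv]; exact (Algebra.commutes u l).symm
    exact this.units_inv_right
  refine ⟨LinearMap.toSpanSingleton Λ Y ((↑v⁻¹ : Λ) • y), fun x hx ↦ ?_⟩
  rw [LinearMap.toSpanSingleton_apply, smul_smul, hc, mul_smul, hy ⟨x, hx⟩,
    ← algebraMap_smul Λ u, ← hv, smul_smul, Units.inv_mul, one_smul]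

end InjectiveLocalization

/-! ### Injective dimension and localization -/

section InjectiveDimensionLocalization

open ModuleCat

variable {C : Type u} [CommRing C] (W : Submonoid C) {Λ Λ' : Type u} [Ring Λ] [Ring Λ']
  [Algebra C Λ] [Algebra C Λ'] (α : Λ →ₐ[C] Λ') [IsLocalizedModule W α.toLinearMap]

/-- The localization of a bundled `Λ`-module at central elements. -/
noncomputable def localizedObj (Y : ModuleCat.{u} Λ) : ModuleCat.{u} Λ' :=
  letI := Module.compHom Y (algebraMap C Λ)
  haveI : IsScalarTower C Λ Y := IsScalarTower.of_compHom C Λ Y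
  localizedModuleCat W α Y

/-- Localized modules are unique up to isomorphism. -/
lemma nonempty_iso_of_isLocalizedModule {X X' : Type u} [AddCommGroup X] [Module C X] [Module Λ X]
    [IsScalarTower C Λ X] [AddCommGroup X'] [Module C X'] [Module Λ' X'] [IsScalarTower C Λ' X']
    (j : X →ₗ[C] X') [IsLocalizedModule W j] (hj : ∀ (l : Λ) x, j (l • x) = α l • j x) :
    Nonempty (localizedObj W α (of Λ X) ≅ of Λ' X') := by
  -- `localizedObj` uses the C-action pulled back from Λ, which must first be identified with the
  -- given one.
  have hinst : (Module.compHom X (algebraMap C Λ) : Module C X) = ‹Module C X› :=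
    Module.ext' _ _ fun c x ↦ algebraMap_smul Λ c x
  subst hinst
  let inst₁ : Module C X := Module.compHom X (algebraMap C Λ)
  change Nonempty (localizedModuleCat W α X ≅ of Λ' X')
  obtain ⟨F, hF, hF'⟩ := exists_lift_of_isLocalizedModule W α (localizedModuleCatMk W α X)
    (localizedModuleCatMk_smul W α X) j hj
  refine ⟨(LinearEquiv.ofBijective F ⟨hF' fun x hx ↦ ?_, fun x ↦ ?_⟩).toModuleIso⟩
  · exact (IsLocalizedModule.eq_zero_iff W _).2 ((IsLocalizedModule.eq_zero_iff W j).1 hx)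
  · obtain ⟨⟨x', w⟩, h⟩ := IsLocalizedModule.surj W j x
    replace h : (w : C) • x = j x' := h
    obtain ⟨z, hz⟩ := ((Module.End.isUnit_iff _).1
      (IsLocalizedModule.map_units (localizedModuleCatMk W α X) w)).2 (localizedModuleCatMk W α X x')
    replace hz : (w : C) • z = localizedModuleCatMk W α X x' := hz
    refine ⟨z, ((Module.End.isUnit_iff _).1 (IsLocalizedModule.map_units j w)).1 ?_⟩
    change (w : C) • F z = (w : C) • x
    rw [← F.map_smul_of_tower, hz, hF, h]

lemma exists_shortExact_localizedObj (S : ShortComplex (ModuleCat.{u} Λ)) (hS : S.ShortExact) :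
    ∃ T : ShortComplex (ModuleCat.{u} Λ'), T.ShortExact ∧ T.X₁ = localizedObj W α S.X₁ ∧
        T.X₂ = localizedObj W α S.X₂ ∧ T.X₃ = localizedObj W α S.X₃ := by
  have h1 := (ShortComplex.ShortExact.moduleCat_exact_iff_function_exact S).1 hS.exact
  have h2 := (ModuleCat.mono_iff_injective _).1 hS.mono_f
  have h3 := (ModuleCat.epi_iff_surjective _).1 hS.epi_g
  let inst₁ := Module.compHom S.X₁ (algebraMap C Λ)
  let inst₂ := Module.compHom S.X₂ (algebraMap C Λ)
  let inst₃ := Module.compHom S.X₃ (algebraMap C Λ)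
  have : IsScalarTower C Λ S.X₁ := IsScalarTower.of_compHom C Λ S.X₁
  have : IsScalarTower C Λ S.X₂ := IsScalarTower.of_compHom C Λ S.X₂
  have : IsScalarTower C Λ S.X₃ := IsScalarTower.of_compHom C Λ S.X₃
  have key {X Y : ModuleCat.{u} Λ} [Module C X] [Module C Y] [IsScalarTower C Λ X]
      [IsScalarTower C Λ Y] (f : X →ₗ[Λ] Y) :
      ∃ F : localizedModuleCat W α X →ₗ[Λ'] localizedModuleCat W α Y,
        ∀ x, F x = IsLocalizedModule.map W (localizedModuleCatMk W α X)
          (localizedModuleCatMk W α Y) (f.restrictScalars C) x := by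
    obtain ⟨F, hF, -⟩ := exists_lift_of_isLocalizedModule W α (localizedModuleCatMk W α X)
      (localizedModuleCatMk_smul W α X) (localizedModuleCatMk W α Y ∘ₗ f.restrictScalars C)
      (fun l x ↦ (congrArg _ (f.map_smul l x)).trans (localizedModuleCatMk_smul W α Y l (f x)))
    refine ⟨F, fun x ↦ ?_⟩
    refine LinearMap.congr_fun (IsLocalizedModule.ext W (localizedModuleCatMk W α X)
      (IsLocalizedModule.map_units (localizedModuleCatMk W α Y))
      (j := F.restrictScalars C) ?_) x
    ext x
    rw [LinearMap.comp_apply, LinearMap.comp_apply, IsLocalizedModule.map_apply]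
    exact hF x
  obtain ⟨F, hF⟩ := key S.f.hom
  obtain ⟨K, hK⟩ := key S.g.hom
  have hex : Function.Exact F K := by
    have := IsLocalizedModule.map_exact W (localizedModuleCatMk W α S.X₁)
      (localizedModuleCatMk W α S.X₂) (localizedModuleCatMk W α S.X₃) (S.f.hom.restrictScalars C)
      (S.g.hom.restrictScalars C) h1
    rwa [← funext hF, ← funext hK] at this
  refine ⟨ModuleCat.shortComplexOfCompEqZero F K hex.linearMap_comp_eq_zero,
    ModuleCat.shortComplex_shortExact _ hex ?_ ?_, rfl, rfl, rfl⟩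
  · change Function.Injective F
    rw [funext hF]
    exact IsLocalizedModule.map_injective W (localizedModuleCatMk W α S.X₁)
      (localizedModuleCatMk W α S.X₂) (S.f.hom.restrictScalars C) h2
  · change Function.Surjective K
    rw [funext hK]
    exact IsLocalizedModule.map_surjective W (localizedModuleCatMk W α S.X₂)
      (localizedModuleCatMk W α S.X₃) (S.g.hom.restrictScalars C) h3

lemma injective_localizedObj [IsNoetherianRing Λ] (Y : ModuleCat.{u} Λ) (hY : Injective Y) :
    Injective (localizedObj W α Y) := by
  let inst₁ := Module.compHom Y (algebraMap C Λ)
  have : IsScalarTower C Λ Y := IsScalarTower.of_compHom C Λ Y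
  have hB : Module.Baer Λ Y :=
    Module.Baer.of_injective (Module.injective_module_of_injective_object Λ Y)
  have := baer_of_isLocalizedModule W α (localizedModuleCatMk W α Y)
    (localizedModuleCatMk_smul W α Y) hB
  exact (Module.injective_iff_injective_object Λ' (localizedModuleCat W α Y)).1 this.injective

lemma hasInjectiveDimensionLE_localizedObj [IsNoetherianRing Λ] (n : ℕ) (Y : ModuleCat.{u} Λ)
    (hY : HasInjectiveDimensionLE Y n) : HasInjectiveDimensionLE (localizedObj W α Y) n :=
  hasInjectiveDimensionLE_obj (localizedObj W α) (exists_shortExact_localizedObj W α)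
    (injective_localizedObj W α) n Y hY

/-- The condition `hW` is joint density of the W i: an ideal of C meeting each of them contains an
element that becomes a unit in Λ. -/
lemma hasInjectiveDimensionLE_of_forall_localizedObj [IsNoetherianRing Λ] {ι : Type*}
    (W : ι → Submonoid C) (Λ' : ι → Type u) [∀ i, Ring (Λ' i)] [∀ i, Algebra C (Λ' i)]
    (α : ∀ i, Λ →ₐ[C] Λ' i) [∀ i, IsLocalizedModule (W i) (α i).toLinearMap]
    (hW : ∀ J : Ideal C, (∀ i, ∃ w ∈ W i, w ∈ J) → ∃ u ∈ J, IsUnit (algebraMap C Λ u))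
    (n : ℕ) (Y : ModuleCat.{u} Λ)
    (hY : ∀ i, HasInjectiveDimensionLE (localizedObj (W i) (α i) Y) n) :
    HasInjectiveDimensionLE Y n := by
  refine hasInjectiveDimensionLE_of_obj (fun i ↦ localizedObj (W i) (α i))
    (fun i ↦ exists_shortExact_localizedObj (W i) (α i))
    (fun i ↦ injective_localizedObj (W i) (α i)) (fun I hI ↦ ?_) n Y hY
  let inst₁ := Module.compHom I (algebraMap C Λ)
  have : IsScalarTower C Λ I := IsScalarTower.of_compHom C Λ I
  refine (Module.injective_iff_injective_object Λ I).1 (Module.Baer.injective ?_)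
  refine baer_of_forall_isLocalizedModule W Λ' α hW I fun i ↦ Module.Baer.of_injective ?_
  have : Injective (of (Λ' i) (localizedModuleCat (W i) (α i) I)) := hI i
  exact Module.injective_module_of_injective_object _ _

lemma nonempty_localizedObj_self_iso : Nonempty (localizedObj W α (of Λ Λ) ≅ of Λ' Λ') :=
  nonempty_iso_of_isLocalizedModule W α α.toLinearMap fun _ _ ↦ map_mul α _ _

include W α in
lemma hasInjectiveDimensionLE_self_of_isLocalizedModule [IsNoetherianRing Λ] (n : ℕ)
    (h : HasInjectiveDimensionLE (of Λ Λ) n) : HasInjectiveDimensionLE (of Λ' Λ') n := by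
  have := hasInjectiveDimensionLE_localizedObj W α n _ h
  exact hasInjectiveDimensionLT_of_iso (nonempty_localizedObj_self_iso W α).some _

include W α in
-- Every Λ'-module is its own localization when regarded over Λ.
lemma forall_hasInjectiveDimensionLE_of_isLocalizedModule [IsNoetherianRing Λ] (n : ℕ)
    (h : ∀ Y : ModuleCat.{u} Λ, HasInjectiveDimensionLE Y n) (Y' : ModuleCat.{u} Λ') :
    HasInjectiveDimensionLE Y' n := by
  let inst₁ := Module.compHom Y' (algebraMap C Λ')
  have : IsScalarTower C Λ' Y' := IsScalarTower.of_compHom C Λ' Y'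
  let inst₂ : Module Λ Y' := Module.compHom Y' α.toRingHom
  have : IsScalarTower C Λ Y' := isScalarTower_compHom_algHom α
  have hloc : IsLocalizedModule W (LinearMap.id (R := C) (M := Y')) :=
    { map_units := isUnit_algebraMap_end_of_isLocalizedModule W α
      surj := fun y ↦ ⟨(y, 1), one_smul _ _⟩
      exists_of_eq := fun h ↦ ⟨1, congrArg _ h⟩ }
  have := hasInjectiveDimensionLE_localizedObj W α n _ (h (of Λ Y'))
  exact hasInjectiveDimensionLT_of_iso
    (nonempty_iso_of_isLocalizedModule W α (LinearMap.id (R := C) (M := Y')) fun _ _ ↦ rfl).some _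

end InjectiveDimensionLocalization

/-! ### Regular sequences bound the self-injective dimension below -/

section RegularSequence

open Abelian RingTheory.Sequence Pointwise

variable {C : Type u} [CommRing C] {Λ : Type u} [Ring Λ] [Algebra C Λ]

/-- Modules over an algebra form a linear category over the base ring. -/
@[reducible]
noncomputable def moduleCatLinear (C : Type u) [CommRing C] (Λ : Type u) [Ring Λ] [Algebra C Λ] :
    Linear C (ModuleCat.{u} Λ) :=
  letI (M : ModuleCat.{u} Λ) : Module C M := Module.restrictScalars C Λ M
  haveI (M : ModuleCat.{u} Λ) : IsScalarTower C Λ M := IsScalarTower.restrictScalars C Λ M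
  { homModule := fun _ _ ↦ inferInstance }

/-- Multiplication by a scalar of the base ring, as an endomorphism of a module. -/
def scalarEnd (c : C) (Y : Type u) [AddCommGroup Y] [Module Λ Y] : Y →ₗ[Λ] Y where
  toFun y := algebraMap C Λ c • y
  map_add' := smul_add _
  map_smul' l y := by rw [RingHom.id_apply, smul_smul, smul_smul, Algebra.commutes]

/-- A central scalar induces the same map on Ext(T, Y) through T and through Y, and through T it is
zero. -/
lemma Ext_comp_scalarEnd_eq_zero (c : C) (T Y : ModuleCat.{u} Λ)
    (hT : ∀ t : T, algebraMap C Λ c • t = 0) {n : ℕ} (e : Ext T Y n) :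
    e.comp (Ext.mk₀ (ModuleCat.ofHom (scalarEnd (Λ := Λ) c Y))) (add_zero n) = 0 := by
  let := moduleCatLinear C Λ
  have hY : (ModuleCat.ofHom (scalarEnd (Λ := Λ) c Y) : Y ⟶ Y) = c • 𝟙 Y := rfl
  have hT' : c • 𝟙 T = 0 := by ext t; exact hT t
  rw [hY, Ext.mk₀_smul, Ext.comp_smul, Ext.comp_mk₀_id, ← Ext.mk₀_id_comp e, ← Ext.smul_comp,
    ← Ext.mk₀_smul, hT', Ext.mk₀_zero, Ext.zero_comp]

/-- `Ext` into a module with a regular sequence of central elements, from modules killed by the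
sequence, vanishes below the length of the sequence, and not in general in that degree. -/
lemma exists_nontrivial_ext_of_isRegular (rs : List C) (Y : Type u) [AddCommGroup Y] [Module C Y]
    [Module Λ Y] [IsScalarTower C Λ Y] (h : IsRegular Y rs) :
    ∃ Z : ModuleCat.{u} Λ, Nontrivial Z ∧ (∃ q : Y →ₗ[Λ] Z, Function.Surjective q) ∧
      (∀ r ∈ rs, ∀ z : Z, algebraMap C Λ r • z = 0) ∧
      ∀ T : ModuleCat.{u} Λ, (∀ r ∈ rs, ∀ t : T, algebraMap C Λ r • t = 0) →
        (∀ i < rs.length, Subsingleton (Ext T (ModuleCat.of Λ Y) i)) ∧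
        (Nontrivial (T ⟶ Z) → Nontrivial (Ext T (ModuleCat.of Λ Y) rs.length)) := by
  induction rs generalizing Y with
  | nil =>
    refine ⟨ModuleCat.of Λ Y, h.nontrivial, ⟨LinearMap.id, Function.surjective_id⟩, by simp,
      fun T _ ↦ ⟨by simp, fun _ ↦ ?_⟩⟩
    exact (Ext.addEquiv₀ (X := T) (Y := ModuleCat.of Λ Y)).toEquiv.nontrivial
  | cons r rs ih =>
    rw [isRegular_cons_iff] at h
    obtain ⟨hr, hrs⟩ := h
    let s : Y →ₗ[Λ] Y := scalarEnd r Y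
    have hs (y : Y) : s y = r • y := algebraMap_smul Λ r y
    let Y₁ := Y ⧸ LinearMap.range s
    have e : QuotSMulTop r Y ≃ₗ[C] Y₁ :=
      (Submodule.quotEquivOfEq _ ((LinearMap.range s).restrictScalars C) (by
        ext y
        simp [Submodule.mem_smul_pointwise_iff_exists, hs])).trans
        (Submodule.Quotient.restrictScalarsEquiv C (LinearMap.range s))
    obtain ⟨Z, hZ, ⟨q, hq⟩, hrsZ, hT⟩ := ih Y₁ ((e.isRegular_congr rs).1 hrs)
    have hex : Function.Exact s (LinearMap.range s).mkQ := LinearMap.exact_map_mkQ_range s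
    let S := ModuleCat.shortComplexOfCompEqZero s _ hex.linearMap_comp_eq_zero
    have hS : S.ShortExact := ModuleCat.shortComplex_shortExact S hex
      (fun x y (hxy : s x = s y) ↦ hr (by simpa only [hs] using hxy)) (Submodule.mkQ_surjective _)
    refine ⟨Z, hZ, ⟨q ∘ₗ (LinearMap.range s).mkQ, hq.comp (Submodule.mkQ_surjective _)⟩,
      ?_, fun T hrT ↦ ?_⟩
    · intro r' hr' z
      rcases List.mem_cons.1 hr' with rfl | hr'
      · obtain ⟨y, rfl⟩ := hq z
        obtain ⟨y, rfl⟩ := Submodule.mkQ_surjective _ y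
        have : (LinearMap.range s).mkQ (algebraMap C Λ r' • y) = 0 :=
          (Submodule.Quotient.mk_eq_zero (LinearMap.range s)).2 ⟨y, rfl⟩
        rw [← map_smul, ← map_smul, this, map_zero]
      · exact hrsZ r' hr' z
    obtain ⟨h1, h2⟩ := hT T fun r' hr' ↦ hrT r' (List.mem_cons_of_mem _ hr')
    -- Since r acts as zero on Ext(T, Y), every class of positive degree in it comes from Ext(T,
    -- Y/rY) in one degree less.
    have hzero {n : ℕ} (x : Ext T (ModuleCat.of Λ Y) n) :
        x.comp (Ext.mk₀ S.f) (add_zero n) = 0 :=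
      Ext_comp_scalarEnd_eq_zero r T (ModuleCat.of Λ Y) (hrT r List.mem_cons_self) x
    have hvan : ∀ i < (r :: rs).length, Subsingleton (Ext T (ModuleCat.of Λ Y) i) := by
      intro i hi
      refine subsingleton_of_forall_eq 0 fun x ↦ ?_
      match i with
      | 0 =>
        have := hS.mono_f
        exact Ext.postcomp_mk₀_injective_of_mono T S.f ((hzero x).trans (hzero 0).symm)
      | i + 1 =>
        obtain ⟨x₃, rfl⟩ := Ext.covariant_sequence_exact₁ T hS x (hzero x) rfl
        have := h1 i (by simpa using hi)
        rw [Subsingleton.elim x₃ 0, Ext.zero_comp]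
    refine ⟨hvan, fun hTZ ↦ ?_⟩
    have := h2 hTZ
    obtain ⟨x₃, hx₃⟩ := exists_ne (0 : Ext T (ModuleCat.of Λ Y₁) rs.length)
    -- The connecting map is injective here, because Ext(T, Y) already vanishes in degree
    -- `rs.length`, one below the length of `r :: rs`.
    refine ⟨x₃.comp hS.extClass rfl, 0, fun h0 ↦ hx₃ ?_⟩
    obtain ⟨x₂, rfl⟩ := Ext.covariant_sequence_exact₃ T hS x₃ rfl h0
    have := hvan rs.length (by simp)
    rw [Subsingleton.elim x₂ 0, Ext.zero_comp]

/-- The length of a regular sequence of central elements bounds the self-injective dimension from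
below. -/
lemma length_le_selfInjDim (rs : List C) (h : IsRegular Λ rs) :
    (rs.length : WithBot ℕ∞) ≤ selfInjDim Λ := by
  rw [show (rs.length : WithBot ℕ∞) = ((rs.length : ℕ) : WithBot ℕ∞) from rfl, le_selfInjDim_iff]
  intro hlt
  obtain ⟨Z, hZ, -, hrs, hT⟩ := exists_nontrivial_ext_of_isRegular (Λ := Λ) rs Λ h
  -- The quotient Z by the sequence serves as its own test module: the identity is a nonzero map Z →
  -- Z.
  have h2 := (hT Z hrs).2 (by
    refine ⟨𝟙 Z, 0, fun h0 ↦ ?_⟩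
    obtain ⟨z, hz⟩ := exists_ne (0 : Z)
    exact hz congr($h0 z))
  exact not_subsingleton _ (HasInjectiveDimensionLT.subsingleton (ModuleCat.of Λ Λ) rs.length
    rs.length le_rfl Z)

end RegularSequence

/-! ### Going down and heights of primes -/

section Height

variable {R S : Type u} [CommRing R] [CommRing S] [Algebra R S]

/-- Going down for torsion-free integral extensions of normal domains. -/
lemma hasGoingDown_of_isTorsionFree [IsDomain R] [IsIntegrallyClosed R] [Algebra.IsIntegral R S]
    (htf : ∀ (r : R) (s : S), r • s = 0 → r = 0 ∨ s = 0) : Algebra.HasGoingDown R S where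
  exists_ideal_le_liesOver_of_lt {p} _ Q _ hpQ := by
    -- Elements of a minimal prime are zero divisors, so q₀ meets R in 0 by torsion-freeness. Going
    -- down is then taken from the integral extension of domains R ⊂ S/q₀.
    obtain ⟨q₀, hq₀, hq₀Q⟩ := Ideal.exists_minimalPrimes_le (bot_le : (⊥ : Ideal S) ≤ Q)
    have hprime : q₀.IsPrime := hq₀.1.1
    have hinj : Function.Injective (algebraMap R (S ⧸ q₀)) := by
      rw [injective_iff_map_eq_zero]
      intro r hr
      have hr' : algebraMap R S r ∈ q₀ := by
        rwa [IsScalarTower.algebraMap_apply R S, Ideal.Quotient.algebraMap_eq,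
          Ideal.Quotient.eq_zero_iff_mem] at hr
      obtain ⟨s, hs, hxy⟩ := Ideal.exists_mul_mem_of_mem_minimalPrimes hq₀ hr'
      rw [Ideal.mem_bot, ← Algebra.smul_def] at hxy
      exact (htf r s hxy).resolve_right hs
    have : FaithfulSMul R (S ⧸ q₀) := (faithfulSMul_iff_algebraMap_injective _ _).2 hinj
    let Q' := Q.map (Ideal.Quotient.mk q₀)
    have hQ' : Q'.comap (Ideal.Quotient.mk q₀) = Q := by
      rw [Ideal.comap_map_of_surjective _ Ideal.Quotient.mk_surjective, ← RingHom.ker_eq_comap_bot,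
        Ideal.mk_ker, sup_eq_left.2 hq₀Q]
    have : Q'.IsPrime := Ideal.map_isPrime_of_surjective Ideal.Quotient.mk_surjective
      (by rwa [Ideal.mk_ker])
    have hunder : Q'.under R = Q.under R := by
      rw [Ideal.under_def, Ideal.under_def, ← hQ', Ideal.comap_comap]
      rfl
    obtain ⟨P, hP, hPp, hPo⟩ := Algebra.HasGoingDown.exists_ideal_le_liesOver_of_lt (p := p) Q'
      (by rwa [hunder])
    refine ⟨P.comap (Ideal.Quotient.mk q₀), ?_, inferInstance, ⟨?_⟩⟩
    · rw [← hQ']; exact Ideal.comap_mono hP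
    · rw [hPo.over, Ideal.under_def, Ideal.under_def, Ideal.comap_comap]
      rfl

/-- Chains below P stay strict in R by incomparability, which gives ≤; going down gives ≥. -/
lemma height_eq_of_liesOver [IsNoetherianRing R] [IsNoetherianRing S] [Algebra.IsIntegral R S]
    [Algebra.HasGoingDown R S] (p : Ideal R) [p.IsPrime] (P : Ideal S) [P.IsPrime]
    [P.LiesOver p] : P.height = p.height := by
  apply le_antisymm
  · let f : PrimeSpectrum S → PrimeSpectrum R := PrimeSpectrum.comap (algebraMap R S)
    have hf : StrictMono f := fun I J hIJ ↦ Ideal.IsIntegral.comap_lt_comap (R := R) hIJ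
    have := Order.height_le_height_apply_of_strictMono f hf ⟨P, inferInstance⟩
    have hfP : f ⟨P, inferInstance⟩ = ⟨p, inferInstance⟩ :=
      PrimeSpectrum.ext (Ideal.LiesOver.over (P := P) (p := p)).symm
    rw [hfP] at this
    rwa [← PrimeSpectrum.height_eq_orderHeight, ← PrimeSpectrum.height_eq_orderHeight] at this
  · rw [Ideal.height_eq_height_add_of_liesOver_of_hasGoingDown p P]
    exact le_self_add

lemma ringKrullDim_localization_eq_of_liesOver [IsNoetherianRing R] [IsNoetherianRing S] [Algebra.IsIntegral R S]
    [Algebra.HasGoingDown R S] (p : Ideal R) [p.IsPrime] (P : Ideal S) [P.IsPrime]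
    [P.LiesOver p] : ringKrullDim (Localization.AtPrime P) = ringKrullDim (Localization.AtPrime p) := by
  rw [IsLocalization.AtPrime.ringKrullDim_eq_height P, IsLocalization.AtPrime.ringKrullDim_eq_height p,
    height_eq_of_liesOver p P]

/-- An ideal that meets the base ring inside a prime lies in a prime over that prime. -/
lemma exists_le_liesOver [Algebra.IsIntegral R S] (p : Ideal R) [p.IsPrime] (J : Ideal S)
    (hJ : ∀ r ∉ p, algebraMap R S r ∉ J) : ∃ q : Ideal S, J ≤ q ∧ q.IsPrime ∧ q.LiesOver p := by
  obtain ⟨q, hq, hq', hq''⟩ := Ideal.exists_ideal_over_prime_of_isIntegral p J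
    (fun r hr ↦ by by_contra h; exact hJ r h hr)
  exact ⟨q, hq, hq', ⟨hq''.symm⟩⟩

lemma eq_of_le_of_liesOver [Algebra.IsIntegral R S] (p : Ideal R) [p.IsPrime] (P Q : Ideal S)
    [P.IsPrime] [Q.LiesOver p] (h : P ≤ Q) (hp : p ≤ P.under R) : P = Q := by
  by_contra hne
  have := Ideal.IsIntegral.comap_lt_comap (R := R) (lt_of_le_of_ne h hne)
  have hQ : p = Q.comap (algebraMap R S) := Ideal.LiesOver.over
  rw [← hQ] at this
  exact absurd (lt_of_le_of_lt hp this) (lt_irrefl _)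

end Height

/-! ### Depth over a noetherian local ring -/

section Depth

variable {R : Type u} [CommRing R] [IsLocalRing R] [IsNoetherianRing R] (M : Type u)
  [AddCommGroup M] [Module R M] [Module.Finite R M]

open RingTheory.Sequence IsLocalRing

omit [IsNoetherianRing R] [Module.Finite R M] in
lemma exists_isWeaklyRegular_of_le_localDepth [Nontrivial M] (n : ℕ)
    (h : (n : ℕ∞) ≤ localDepth R M) :
    ∃ rs : List R, (∀ r ∈ rs, r ∈ maximalIdeal R) ∧ IsWeaklyRegular M rs ∧ rs.length = n := by
  cases n with
  | zero => exact ⟨[], by simp, IsWeaklyRegular.nil R M, rfl⟩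
  | succ n =>
    -- A supremum above n is exceeded by some member, of length at least n + 1, which is then
    -- truncated; this also covers infinite suprema.
    have h1 : (n : ℕ∞) < localDepth R M := lt_of_lt_of_le (by exact_mod_cast Nat.lt_succ_self n) h
    simp only [localDepth, lt_iSup_iff] at h1
    obtain ⟨rs, hrs, hm, hlen⟩ := h1
    have hlen' : n + 1 ≤ rs.length := by exact_mod_cast hlen
    refine ⟨rs.take (n + 1), fun r hr ↦ hm r (List.mem_of_mem_take hr), ?_, by simpa using hlen'⟩
    have := hrs.toIsWeaklyRegular
    rw [← List.take_append_drop (n + 1) rs, isWeaklyRegular_append_iff] at this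
    exact this.1

lemma length_le_ringKrullDim [Nontrivial M] (rs : List R) (hm : ∀ r ∈ rs, r ∈ maximalIdeal R)
    (h : IsWeaklyRegular M rs) : (rs.length : WithBot ℕ∞) ≤ ringKrullDim R := by
  have hreg := IsRegular.of_isWeaklyRegular_of_mem_maximalIdeal M hm h
  have h1 := Module.supportDim_add_length_eq_supportDim_of_isRegular rs hreg
  have : Nontrivial (M ⧸ (Ideal.ofList rs • ⊤ : Submodule R M)) := hreg.quot_ofList_smul_nontrivial ⊤
  have h2 : (0 : WithBot ℕ∞) ≤ Module.supportDim R (M ⧸ (Ideal.ofList rs • ⊤ : Submodule R M)) :=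
    haveI := (Module.nonempty_support_of_nontrivial (R := R)
      (M := M ⧸ (Ideal.ofList rs • ⊤ : Submodule R M))).to_subtype
    Order.krullDim_nonneg
  calc (rs.length : WithBot ℕ∞) = 0 + rs.length := (zero_add _).symm
    _ ≤ _ := add_le_add_left h2 _
    _ = _ := h1
    _ ≤ _ := Module.supportDim_le_ringKrullDim R M

/-- A module has maximal depth if and only if there is a regular sequence of length the dimension of
the ring. -/
lemma localDepth_eq_ringKrullDim_iff [Nontrivial M] (n : ℕ) (hn : ringKrullDim R = n) :
    (localDepth R M : WithBot ℕ∞) = ringKrullDim R ↔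
      ∃ rs : List R, (∀ r ∈ rs, r ∈ maximalIdeal R) ∧ IsWeaklyRegular M rs ∧ rs.length = n := by
  constructor
  · intro h
    apply exists_isWeaklyRegular_of_le_localDepth
    rw [hn] at h
    exact (WithBot.coe_inj.1 h).ge
  · rintro ⟨rs, hm, hrs, rfl⟩
    apply le_antisymm
    · rw [hn]
      refine WithBot.coe_le_coe.2 (iSup_le fun rs' ↦ iSup_le fun hrs' ↦ iSup_le fun hm' ↦ ?_)
      have := length_le_ringKrullDim M rs' hm' hrs'.toIsWeaklyRegular
      rw [hn] at this
      exact WithBot.coe_le_coe.1 this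
    · rw [hn]
      refine WithBot.coe_le_coe.2 ?_
      exact le_iSup_of_le rs (le_iSup_of_le (IsRegular.of_isWeaklyRegular_of_mem_maximalIdeal M hm hrs)
        (le_iSup_of_le hm le_rfl))

omit [IsLocalRing R] [IsNoetherianRing R] [Module.Finite R M] in
lemma isWeaklyRegular_of_subsingleton [Subsingleton M] (rs : List R) : IsWeaklyRegular M rs :=
  ⟨fun i h x y _ ↦ by
    have : Subsingleton (M ⧸ (Ideal.ofList (rs.take i) • ⊤ : Submodule R M)) :=
      (Submodule.mkQ_surjective _).subsingleton
    exact Subsingleton.elim _ _⟩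

/-- Dividing out a regular element lowers the depth by at most one. -/
lemma exists_isWeaklyRegular_quotSMulTop (x : R) (hx : x ∈ maximalIdeal R)
    (hreg : IsSMulRegular M x) (rs : List R) (hm : ∀ r ∈ rs, r ∈ maximalIdeal R)
    (hrs : IsWeaklyRegular M rs) (n : ℕ) (hn : rs.length = n + 1) :
    ∃ rs' : List R, (∀ r ∈ rs', r ∈ maximalIdeal R) ∧ IsWeaklyRegular (QuotSMulTop x M) rs' ∧
      rs'.length = n := by
  cases subsingleton_or_nontrivial M with
  | inl h =>
    have : Subsingleton (QuotSMulTop x M) := (Submodule.mkQ_surjective _).subsingleton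
    -- On the zero module any sequence is weakly regular, so zeros serve.
    exact ⟨List.replicate n 0, fun r hr ↦ by simp [(List.mem_replicate.1 hr).2],
      isWeaklyRegular_of_subsingleton _ _, by simp⟩
  | inr h =>
    have hlt (L : Type u) [AddCommGroup L] [Module R L] [Module.Finite R L] [Nontrivial L] :
        maximalIdeal R • (⊤ : Submodule R L) < ⊤ :=
      lt_top_iff_ne_top.2 (Submodule.top_ne_ideal_smul_of_le_jacobson_annihilator
        (maximalIdeal_le_jacobson _)).symm
    have hreg' := IsRegular.of_isWeaklyRegular_of_mem_maximalIdeal M hm hrs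
    have hex : ∃ rs : List R, rs.length = n + 1 ∧ (∀ r ∈ rs, r ∈ maximalIdeal R) ∧
      IsRegular (ModuleCat.of R M) rs := ⟨rs, hn, hm, hreg'⟩
    have hext := ((ModuleCat.exists_isRegular_tfae (maximalIdeal R) (n + 1) (ModuleCat.of R M)
      (hlt M)).out 3 1).1 hex
    have := nontrivial_quotSMulTop_of_mem_maximalIdeal M hx
    -- With k the residue field, Ext^i(k, M/xM) lies between Ext^i(k, M) and Ext^(i+1)(k, M), both
    -- zero for i < n.
    obtain ⟨rs', hlen, hm', hrs'⟩ := ((ModuleCat.exists_isRegular_tfae (maximalIdeal R) n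
      (ModuleCat.of R (QuotSMulTop x M)) (hlt _)).out 1 3).1 fun i hi ↦ by
        have h1 := hext i (by omega)
        have h2 := hext (i + 1) (by omega)
        refine subsingleton_of_forall_eq 0 fun e ↦ ?_
        have hS := IsSMulRegular.smulShortComplex_shortExact (M := ModuleCat.of R M) hreg
        obtain ⟨e', rfl⟩ := Abelian.Ext.covariant_sequence_exact₃ _ hS e rfl (h2.elim _ _)
        have : Subsingleton (Abelian.Ext (ModuleCat.of R (Shrink.{u} (R ⧸ maximalIdeal R)))
          (ModuleCat.of R M) i) := h1
        exact (congrArg (fun z ↦ Abelian.Ext.comp z _ _) (h1.elim e' 0)).trans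
          (Abelian.Ext.zero_comp _ _ _ _ _)
    exact ⟨rs', hm', hrs'.toIsWeaklyRegular, hlen⟩

end Depth

/-! ### Depth at a prime, expressed without localizing, and its transfer -/

section DepthAt

open RingTheory.Sequence IsLocalRing Pointwise

/-- The element `a` is regular on the localization of `M` at the prime `p`. -/
def IsRegularAt {R : Type u} [CommRing R] (p : Ideal R) (a : R) (M : Type u) [AddCommGroup M]
    [Module R M] : Prop :=
  ∀ m : M, ∀ w ∉ p, w • a • m = 0 → ∃ w' ∉ p, w' • m = 0

/-- The prime `p` contains a sequence of length `n` that is weakly regular on `M` locally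
at `p`. -/
def HasDepthAt {R : Type u} [CommRing R] (p : Ideal R) :
    ℕ → ∀ (M : Type u) [AddCommGroup M] [Module R M], Prop
  | 0, _, _, _ => True
  | n + 1, M, _, _ => ∃ a ∈ p, IsRegularAt p a M ∧ HasDepthAt p n (QuotSMulTop a M)

section Basic

variable {R : Type u} [CommRing R] (p : Ideal R) {M M' : Type u} [AddCommGroup M] [Module R M]
  [AddCommGroup M'] [Module R M']

variable {p} in
lemma IsRegularAt.of_injective {a : R} (h : IsRegularAt p a M) (f : M' →ₗ[R] M)
    (hf : Function.Injective f) : IsRegularAt p a M' := by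
  intro m w hw hm
  obtain ⟨w', hw', h'⟩ := h (f m) w hw (by rw [← map_smul, ← map_smul, hm, map_zero])
  exact ⟨w', hw', hf (by rw [map_smul, h', map_zero])⟩

lemma HasDepthAt.of_linearEquiv (n : ℕ) (e : M ≃ₗ[R] M') (h : HasDepthAt p n M) :
    HasDepthAt p n M' := by
  induction n generalizing M M' with
  | zero => trivial
  | succ n ih =>
    obtain ⟨a, ha, hreg, h⟩ := h
    exact ⟨a, ha, hreg.of_injective e.symm.toLinearMap e.symm.injective,
      ih (QuotSMulTop.congr a e) h⟩

lemma HasDepthAt.of_retract (n : ℕ) (f : M' →ₗ[R] M) (g : M →ₗ[R] M')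
    (hgf : g ∘ₗ f = LinearMap.id) (h : HasDepthAt p n M) : HasDepthAt p n M' := by
  induction n generalizing M M' with
  | zero => trivial
  | succ n ih =>
    obtain ⟨a, ha, hreg, h⟩ := h
    refine ⟨a, ha, hreg.of_injective f (Function.LeftInverse.injective (LinearMap.congr_fun hgf)),
      ih (QuotSMulTop.map a f) (QuotSMulTop.map a g) ?_ h⟩
    rw [← QuotSMulTop.map_comp, hgf, QuotSMulTop.map_id]

/-- Dividing out an element commutes with powers of a module. -/
noncomputable def quotSMulTopPiEquiv (ι : Type) (a : R) (M : Type u) [AddCommGroup M]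
    [Module R M] : QuotSMulTop a (ι → M) ≃ₗ[R] (ι → QuotSMulTop a M) :=
  (Submodule.quotEquivOfEq _ _ (by
    ext x
    rw [LinearMap.mem_ker, Submodule.mem_smul_pointwise_iff_exists]
    constructor
    · rintro ⟨y, -, rfl⟩
      ext i
      exact (Submodule.Quotient.mk_eq_zero _).2 (Submodule.smul_mem_pointwise_smul _ _ _ trivial)
    · intro h
      have h' (i : ι) : x i ∈ a • (⊤ : Submodule R M) :=
        (Submodule.Quotient.mk_eq_zero _).1 (congrFun h i)
      choose y hy using fun i ↦ (Submodule.mem_smul_pointwise_iff_exists _ _ _).1 (h' i)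
      exact ⟨y, trivial, funext fun i ↦ (hy i).2⟩)).trans
    (LinearMap.quotKerEquivOfSurjective
      (LinearMap.pi fun i ↦ (a • (⊤ : Submodule R M)).mkQ ∘ₗ LinearMap.proj i : (ι → M) →ₗ[R] _)
      fun y ↦ by
        choose x hx using fun i ↦ Submodule.mkQ_surjective _ (y i)
        exact ⟨x, funext hx⟩)

lemma IsRegularAt.pi [hp : p.IsPrime] {ι : Type} [Finite ι] {a : R} (h : IsRegularAt p a M) :
    IsRegularAt p a (ι → M) := by
  intro m w hw hm
  obtain ⟨w', hw', h'⟩ := exists_common_multiple p.primeCompl (fun i r ↦ r • m i = 0)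
    (fun i c d hc ↦ by rw [mul_smul, hc, smul_zero]) (fun i ↦ h (m i) w hw (congrFun hm i))
  exact ⟨w', hw', funext h'⟩

lemma HasDepthAt.pi [p.IsPrime] (ι : Type) [Finite ι] (n : ℕ) (h : HasDepthAt p n M) :
    HasDepthAt p n (ι → M) := by
  induction n generalizing M with
  | zero => trivial
  | succ n ih =>
    obtain ⟨a, ha, hreg, h⟩ := h
    exact ⟨a, ha, hreg.pi, (ih h).of_linearEquiv p n (quotSMulTopPiEquiv ι a M).symm⟩

lemma isSMulRegular_localization_iff [p.IsPrime] (a : R) :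
    IsSMulRegular (Localization.AtPrime p ⊗[R] M) (algebraMap R (Localization.AtPrime p) a) ↔
      IsRegularAt p a M := by
  let j := TensorProduct.mk R (Localization.AtPrime p) M 1
  have h0 (m : M) : j m = 0 ↔ ∃ w ∉ p, w • m = 0 := by
    rw [IsLocalizedModule.eq_zero_iff p.primeCompl j]
    exact ⟨fun ⟨c, hc⟩ ↦ ⟨c, c.2, hc⟩, fun ⟨w, hw, h⟩ ↦ ⟨⟨w, hw⟩, h⟩⟩
  refine (isSMulRegular_iff_right_eq_zero_of_smul (R := Localization.AtPrime p)
    (M := Localization.AtPrime p ⊗[R] M)).trans ?_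
  constructor
  · intro h m w hw hm
    refine (h0 m).1 (h (j m) ?_)
    rw [algebraMap_smul, ← map_smul]
    exact (h0 _).2 ⟨w, hw, hm⟩
  · intro h x hx
    obtain ⟨⟨m, s⟩, hm⟩ := IsLocalizedModule.surj p.primeCompl j x
    replace hm : (s : R) • x = j m := hm
    have h1 : j (a • m) = 0 := by
      rw [map_smul, ← hm, smul_comm, ← algebraMap_smul (Localization.AtPrime p) a, hx, smul_zero]
    obtain ⟨w, hw, h2⟩ := (h0 _).1 h1
    have h3 := (h0 m).2 (h m w hw h2)
    exact ((Module.End.isUnit_iff _).1 (IsLocalizedModule.map_units j s)).1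
      ((hm.trans h3).trans (map_zero _).symm)

lemma isSMulRegular_unit_mul_iff {A X : Type*} [CommRing A] [AddCommGroup X] [Module A X] {u : A}
    (hu : IsUnit u) (x : A) : IsSMulRegular X (u * x) ↔ IsSMulRegular X x := by
  obtain ⟨u, rfl⟩ := hu
  exact IsSMulRegular.mul_iff_right (IsSMulRegular.of_mul_eq_one u.inv_mul)

lemma unit_mul_smul_top {A X : Type*} [CommRing A] [AddCommGroup X] [Module A X] {u : A}
    (hu : IsUnit u) (x : A) : (u * x) • (⊤ : Submodule A X) = x • ⊤ := by
  rw [← Submodule.ideal_span_singleton_smul, ← Submodule.ideal_span_singleton_smul,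
    Ideal.span_singleton_mul_left_unit hu]

/-- Up to a unit, each element of the maximal ideal of R_p comes from p, and units change neither
regularity nor quotients. Elements of R can be compared with elements of S directly, which is the
reason for `HasDepthAt`. -/
lemma hasDepthAt_iff [p.IsPrime] (n : ℕ) : HasDepthAt p n M ↔
    ∃ rs : List (Localization.AtPrime p), (∀ r ∈ rs, r ∈ maximalIdeal (Localization.AtPrime p)) ∧
      IsWeaklyRegular (Localization.AtPrime p ⊗[R] M) rs ∧ rs.length = n := by
  induction n generalizing M with
  | zero => exact ⟨fun _ ↦ ⟨[], by simp, IsWeaklyRegular.nil _ _, rfl⟩, fun _ ↦ trivial⟩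
  | succ n ih =>
    constructor
    · rintro ⟨a, ha, hreg, h⟩
      obtain ⟨rs, hm, hrs, hn⟩ := ih.1 h
      refine ⟨algebraMap R _ a :: rs, ?_, ?_, by simp [hn]⟩
      · rintro r (_ | ⟨_, hr⟩)
        · exact (IsLocalization.AtPrime.to_map_mem_maximal_iff _ p a).2 ha
        · exact hm r hr
      · rw [isWeaklyRegular_cons_iff]
        refine ⟨(isSMulRegular_localization_iff p a).2 hreg, ?_⟩
        exact ((QuotSMulTop.algebraMapTensorEquivTensorQuotSMulTop a M
          (Localization.AtPrime p)).isWeaklyRegular_congr rs).2 hrs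
    · rintro ⟨_ | ⟨x, rs⟩, hm, hrs, hn⟩
      · simp at hn
      rw [isWeaklyRegular_cons_iff] at hrs
      obtain ⟨⟨a, s⟩, has⟩ := IsLocalization.surj p.primeCompl x
      have hs := IsLocalization.map_units (Localization.AtPrime p) s
      replace has : algebraMap R (Localization.AtPrime p) s * x = algebraMap R _ a := by
        rw [mul_comm]; exact has
      refine ⟨a, ?_, ?_, ih.2 ⟨rs, fun r hr ↦ hm r (List.mem_cons_of_mem _ hr), ?_, by simpa using hn⟩⟩
      · rw [← IsLocalization.AtPrime.to_map_mem_maximal_iff (Localization.AtPrime p) p, ← has]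
        exact Ideal.mul_mem_left _ _ (hm x List.mem_cons_self)
      · rw [← isSMulRegular_localization_iff, ← has]
        exact (isSMulRegular_unit_mul_iff hs x).2 hrs.1
      · refine ((QuotSMulTop.algebraMapTensorEquivTensorQuotSMulTop a M
          (Localization.AtPrime p)).isWeaklyRegular_congr rs).1 ?_
        refine ((Submodule.quotEquivOfEq _ _ ?_).isWeaklyRegular_congr rs).1 hrs.2
        rw [← has, unit_mul_smul_top hs]

/-- `HasDepthAt` provides some first element; over a noetherian ring any regular one will do. -/
lemma HasDepthAt.quotSMulTop [IsNoetherianRing R] [Module.Finite R M] [p.IsPrime] (n : ℕ)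
    (h : HasDepthAt p (n + 1) M) (a : R) (ha : a ∈ p) (hreg : IsRegularAt p a M) :
    HasDepthAt p n (QuotSMulTop a M) := by
  obtain ⟨rs, hm, hrs, hn⟩ := (hasDepthAt_iff p (n + 1)).1 h
  obtain ⟨rs', hm', hrs', hn'⟩ := exists_isWeaklyRegular_quotSMulTop
    (Localization.AtPrime p ⊗[R] M) (algebraMap R _ a)
    ((IsLocalization.AtPrime.to_map_mem_maximal_iff (Localization.AtPrime p) p a).2 ha)
    ((isSMulRegular_localization_iff p a).2 hreg) rs hm hrs n hn
  exact (hasDepthAt_iff p n).2 ⟨rs', hm', ((QuotSMulTop.algebraMapTensorEquivTensorQuotSMulTop a M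
    (Localization.AtPrime p)).isWeaklyRegular_congr rs').1 hrs', hn'⟩

/-- Either a prime contains an element that is locally regular, or it is, locally, an associated
prime. -/
lemma exists_isRegularAt_or [IsNoetherianRing R] [Module.Finite R M] [p.IsPrime] :
    (∃ a ∈ p, IsRegularAt p a M) ∨
      ∃ m : M, (∀ w ∉ p, w • m ≠ 0) ∧ ∀ a ∈ p, a • m = 0 := by
  let A := Localization.AtPrime p
  let j := TensorProduct.mk R A M 1
  -- A regular element in the maximal ideal exists exactly when the residue field has no nonzero map
  -- to the localized module.
  by_cases hH : Subsingleton ((A ⧸ maximalIdeal A) →ₗ[A] A ⊗[R] M)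
  · left
    obtain ⟨x, hx, hreg⟩ := IsSMulRegular.subsingleton_linearMap_iff.1 hH
    rw [Ideal.annihilator_quotient] at hx
    obtain ⟨⟨a, s⟩, has⟩ := IsLocalization.surj p.primeCompl x
    have hs := IsLocalization.map_units A s
    replace has : algebraMap R A s * x = algebraMap R A a := by
      rw [mul_comm]; exact has
    refine ⟨a, ?_, ?_⟩
    · rw [← IsLocalization.AtPrime.to_map_mem_maximal_iff A p, ← has]
      exact Ideal.mul_mem_left _ _ hx
    · rw [← isSMulRegular_localization_iff, ← has]
      exact (isSMulRegular_unit_mul_iff hs x).2 hreg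
  · right
    rw [not_subsingleton_iff_nontrivial] at hH
    obtain ⟨f, hf⟩ := exists_ne (0 : (A ⧸ maximalIdeal A) →ₗ[A] A ⊗[R] M)
    have hf1 : f 1 ≠ 0 := fun h ↦ hf (by
      ext
      simpa using h)
    have hkill (a : R) (ha : a ∈ p) : a • f 1 = 0 := by
      rw [← algebraMap_smul A a, ← map_smul]
      have : algebraMap R A a • (1 : A ⧸ maximalIdeal A) = 0 := by
        rw [Algebra.smul_def, mul_one]
        exact Ideal.Quotient.eq_zero_iff_mem.2
          ((IsLocalization.AtPrime.to_map_mem_maximal_iff A p a).2 ha)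
      rw [this, map_zero]
    obtain ⟨⟨m, s⟩, hm⟩ := IsLocalizedModule.surj p.primeCompl j (f 1)
    replace hm : (s : R) • f 1 = j m := hm
    have hu (w : R) (hw : w ∉ p) : Function.Injective fun x : A ⊗[R] M ↦ w • x :=
      ((Module.End.isUnit_iff _).1 (IsLocalizedModule.map_units j (⟨w, hw⟩ : p.primeCompl))).1
    -- The element m is killed by p only locally; p is finitely generated, so one w outside p makes
    -- p kill w • m.
    obtain ⟨w, hw, hw'⟩ := exists_smul_eq_zero_of_fg (Λ := R) p.primeCompl
      (LinearMap.toSpanSingleton R M m) p (IsNoetherian.noetherian p) fun a ha ↦ by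
        have : j (a • m) = 0 := by rw [map_smul, ← hm, smul_comm, hkill a ha, smul_zero]
        obtain ⟨c, hc⟩ := (IsLocalizedModule.eq_zero_iff p.primeCompl j).1 this
        exact ⟨c, c.2, hc⟩
    refine ⟨w • m, fun v hv h0 ↦ hf1 ?_, fun a ha ↦ ?_⟩
    · have : (v * w * s) • f 1 = 0 := by
        rw [mul_smul, hm, ← map_smul, mul_smul, h0, map_zero]
      exact hu _ (p.primeCompl.mul_mem (p.primeCompl.mul_mem hv hw) s.2)
        (this.trans (smul_zero _).symm)
    · rw [smul_comm]
      exact hw' a ha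

end Basic

section Transfer

variable {R S : Type u} [CommRing R] [CommRing S] [Algebra R S] (p : Ideal R) [p.IsPrime]
  {M : Type u} [AddCommGroup M] [Module R M] [Module S M] [IsScalarTower R S M]

omit [p.IsPrime] in
lemma algebraMap_notMem_of_liesOver (q : Ideal S) [q.LiesOver p] {w : R} (hw : w ∉ p) :
    algebraMap R S w ∉ q := by
  rwa [← Ideal.mem_of_liesOver q p]

variable {p} in
lemma IsRegularAt.of_liesOver {a : R} (h : IsRegularAt p a M) (q : Ideal S) [q.IsPrime]
    [q.LiesOver p] : IsRegularAt q (algebraMap R S a) M := by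
  intro m w hw hm
  rw [algebraMap_smul, smul_comm] at hm
  obtain ⟨v, hv, h'⟩ := h (w • m) 1 p.primeCompl.one_mem (by rw [one_smul, hm])
  refine ⟨algebraMap R S v * w,
    q.primeCompl.mul_mem (algebraMap_notMem_of_liesOver p q hv) hw, ?_⟩
  rw [mul_smul, algebraMap_smul, h']

lemma quotSMulTop_algebraMap_eq (a : R) :
    ((algebraMap R S a) • (⊤ : Submodule S M)).restrictScalars R = a • (⊤ : Submodule R M) := by
  ext x
  simp [Submodule.mem_smul_pointwise_iff_exists]

/-- Depth descends along integral extensions. -/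
lemma HasDepthAt.of_forall_liesOver [IsNoetherianRing R] [Module.Finite R S] [Module.Finite R M]
    (n : ℕ) (h : ∀ q : Ideal S, q.IsPrime → q.LiesOver p → HasDepthAt q n M) :
    HasDepthAt p n M := by
  induction n generalizing M with
  | zero => trivial
  | succ n ih =>
    have : IsNoetherianRing S := IsNoetherianRing.of_finite R S
    have : Module.Finite S M := Module.Finite.of_restrictScalars_finite R S M
    -- Otherwise p is locally the annihilator of some m. Choose q above p containing the annihilator
    -- of m in S, and b in q regular at q.
    obtain ⟨a, ha, hreg⟩ : ∃ a ∈ p, IsRegularAt p a M := by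
      refine (exists_isRegularAt_or (M := M) p).resolve_right ?_
      rintro ⟨m, hm, hpm⟩
      obtain ⟨q, hJq, hq, hqp⟩ := exists_le_liesOver p (LinearMap.ker (LinearMap.toSpanSingleton S M m))
        fun r hr hr' ↦ hm r hr (by simpa using hr')
      obtain ⟨b, hb, hreg, -⟩ := h q hq hqp
      have hpow (k : ℕ) : ∀ s ∉ q, (b ^ k * s) • m ≠ 0 := by
        induction k with
        | zero =>
          intro s hs h0
          exact hs (hJq (by simpa using h0))
        | succ k ihk =>
          intro s hs h0
          obtain ⟨w', hw', h'⟩ := hreg ((b ^ k) • m) s hs (by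
            rw [← h0, smul_smul, smul_smul]; congr 1; ring)
          exact ihk w' hw' (by rw [← h', smul_smul, mul_comm])
      -- No element of T kills m, whereas pS does. A prime P containing pS and avoiding T lies in q
      -- and contains p, so P = q by incomparability; but b is in q and not in P.
      let T : Submonoid S := Submonoid.powers b ⊔ q.primeCompl
      have hdisj : Disjoint ((p.map (algebraMap R S) : Ideal S) : Set S) (T : Set S) := by
        rw [Set.disjoint_left]
        intro x hx hxT
        obtain ⟨y, ⟨k, rfl⟩, z, hz, rfl⟩ := Submonoid.mem_sup.1 hxT
        refine hpow k z hz ?_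
        have : p.map (algebraMap R S) ≤ LinearMap.ker (LinearMap.toSpanSingleton S M m) := by
          rw [Ideal.map_le_iff_le_comap]
          intro a ha
          simpa using hpm a ha
        exact this hx
      obtain ⟨P, hP, hpP, hPT⟩ := Ideal.exists_le_prime_disjoint _ T hdisj
      rw [Set.disjoint_right] at hPT
      have hPq : P ≤ q := fun x hx ↦ by
        by_contra hxq
        exact hPT (Submonoid.mem_sup_right hxq) hx
      have := eq_of_le_of_liesOver p P q hPq (Ideal.map_le_iff_le_comap.1 hpP)
      exact hPT (Submonoid.mem_sup_left (Submonoid.mem_powers b)) (this ▸ hb)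
    refine ⟨a, ha, hreg, ?_⟩
    -- The same a from p is divided out at every q, regardless of the sequences chosen there.
    have := ih (M := QuotSMulTop (algebraMap R S a) M) fun q hq hqp ↦
      (h q hq hqp).quotSMulTop q n _ ((Ideal.mem_of_liesOver q p a).1 ha) (hreg.of_liesOver q)
    exact this.of_linearEquiv p n ((Submodule.Quotient.restrictScalarsEquiv R _).symm.trans
      (Submodule.quotEquivOfEq _ _ (quotSMulTop_algebraMap_eq a)))

lemma HasDepthAt.of_liesOver (q : Ideal S) [q.IsPrime] [q.LiesOver p] (n : ℕ)
    (h : HasDepthAt p n M) : HasDepthAt q n M := by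
  induction n generalizing M with
  | zero => trivial
  | succ n ih =>
    obtain ⟨a, ha, hreg, h⟩ := h
    refine ⟨algebraMap R S a, (Ideal.mem_of_liesOver q p a).1 ha, hreg.of_liesOver q, ih ?_⟩
    exact h.of_linearEquiv p n ((Submodule.quotEquivOfEq _ _
        (quotSMulTop_algebraMap_eq a).symm).trans (Submodule.Quotient.restrictScalarsEquiv R _))

end Transfer

end DepthAt

/-! ### Projections to homogeneous components -/

section GradedProjection

variable {R M G : Type*} [CommRing R] [AddCommGroup M] [Module R M] [DecidableEq G]
  (ℳ : G → Submodule R M) [DirectSum.Decomposition ℳ]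

/-- The projection of a graded module onto a homogeneous component. -/
def gradedProj (g : G) : M →ₗ[R] M :=
  (ℳ g).subtype ∘ₗ DirectSum.component R G _ g ∘ₗ (DirectSum.decomposeLinearEquiv ℳ).toLinearMap

lemma gradedProj_mem (g : G) (m : M) : gradedProj ℳ g m ∈ ℳ g := SetLike.coe_mem _

lemma gradedProj_of_mem {g : G} {m : M} (hm : m ∈ ℳ g) (h : G) :
    gradedProj ℳ h m = if g = h then m else 0 := by
  split_ifs with hgh
  · subst hgh
    exact DirectSum.decompose_of_mem_same ℳ hm
  · exact DirectSum.decompose_of_mem_ne ℳ hm hgh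

lemma gradedProj_gradedProj (g h : G) (m : M) :
    gradedProj ℳ h (gradedProj ℳ g m) = if g = h then gradedProj ℳ g m else 0 :=
  gradedProj_of_mem ℳ (gradedProj_mem ℳ g m) h

lemma sum_gradedProj [Fintype G] (m : M) : ∑ g, gradedProj ℳ g m = m := by
  have := congrArg (DirectSum.coeAddMonoidHom ℳ) (DirectSum.sum_univ_of (DirectSum.decompose ℳ m))
  rw [map_sum] at this
  simp only [DirectSum.coeAddMonoidHom_of] at this
  exact this.trans ((DirectSum.decompose ℳ).symm_apply_apply m)

lemma eq_zero_of_gradedProj [Fintype G] {m : M} (h : ∀ g, gradedProj ℳ g m = 0) : m = 0 := by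
  rw [← sum_gradedProj ℳ m]
  exact Finset.sum_eq_zero fun g _ ↦ h g

end GradedProjection

section GradedSMul

variable {R S N G : Type*} [AddCommGroup G] [DecidableEq G] [Fintype G] [CommRing R] [CommRing S]
  [Algebra R S] {𝒜 : G → Submodule R S} [AddCommGroup N] [Module S N] [Module R N]
  {𝒩 : G → Submodule R N} [DirectSum.Decomposition 𝒩] [SetLike.GradedSMul 𝒜 𝒩]

omit [DecidableEq G] [Fintype G] [DirectSum.Decomposition 𝒩] in
lemma gradedSMul_mem {g h k : G} (hk : g + h = k) {s : S} (hs : s ∈ 𝒜 g) {n : N} (hn : n ∈ 𝒩 h) :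
    s • n ∈ 𝒩 k := hk ▸ SetLike.GradedSMul.smul_mem hs hn

lemma gradedProj_smul {g : G} {s : S} (hs : s ∈ 𝒜 g) (h k : G) (hk : g + h = k) (n : N) :
    gradedProj 𝒩 k (s • n) = s • gradedProj 𝒩 h n := by
  conv_lhs => rw [← sum_gradedProj 𝒩 n, Finset.smul_sum, map_sum]
  rw [Finset.sum_eq_single h]
  · rw [gradedProj_of_mem 𝒩 (gradedSMul_mem hk hs (gradedProj_mem 𝒩 h n)), if_pos rfl]
  · intro l _ hl
    rw [gradedProj_of_mem 𝒩 (gradedSMul_mem rfl hs (gradedProj_mem 𝒩 l n)), if_neg]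
    rw [← hk]
    simpa using hl
  · simp

end GradedSMul

lemma eq_zero_of_forall_dual {A : Type*} {M : Type*} [CommRing A] [AddCommGroup M] [Module A M]
    (hM : Module.IsReflexive A M) {m : M} (h : ∀ f : Module.Dual A M, f m = 0) : m = 0 :=
  (injective_iff_map_eq_zero (Module.Dual.eval A M)).1 (Module.bijective_dual_eval A M).1 m
    (LinearMap.ext h)

/-! ### Extending maps from one component of a strongly graded module -/

section StronglyGraded

variable {G : Type*} [AddCommGroup G] [DecidableEq G] [Fintype G] {R S : Type*} [CommRing R]
  [CommRing S] [Algebra R S] {𝒜 : G → Submodule R S} [GradedAlgebra 𝒜] (h𝒜 : IsStronglyGraded 𝒜)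
include h𝒜

namespace IsStronglyGraded

lemma eq_zero_of_forall_mul (g : G) {s : S} (hs : ∀ y ∈ 𝒜 g, y * s = 0) : s = 0 := by
  refine eq_zero_of_gradedProj 𝒜 fun h ↦ ?_
  have := @(h𝒜.bijective_mul g h).1 ⟨gradedProj 𝒜 h s, gradedProj_mem 𝒜 h s⟩ 0 (by
    ext ⟨y, hy⟩
    change y * gradedProj 𝒜 h s = y * 0
    have := gradedProj_smul (𝒩 := 𝒜) hy h _ rfl s
    rw [smul_eq_mul, smul_eq_mul] at this
    rw [← this, hs y hy, map_zero, mul_zero])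
  exact congrArg Subtype.val this

/-- Surjectivity of the natural maps, one target degree at a time. With the preceding lemma, S →
Hom_R(S_g, S) is bijective. -/
lemma exists_forall_mul (g : G) (φ : 𝒜 g →ₗ[R] S) : ∃ s : S, ∀ y : 𝒜 g, φ y = y * s := by
  have (h : G) : ∃ x : S, ∀ y : 𝒜 g, gradedProj 𝒜 (g + h) (φ y) = y * x := by
    obtain ⟨x, hx⟩ := (h𝒜.bijective_mul g h).2
      ((gradedProj 𝒜 (g + h) ∘ₗ φ).codRestrict (𝒜 (g + h)) fun y ↦ gradedProj_mem 𝒜 _ _)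
    exact ⟨x, fun y ↦ (congrArg Subtype.val (LinearMap.congr_fun hx y)).symm⟩
  choose x hx using this
  refine ⟨∑ h, x h, fun y ↦ ?_⟩
  rw [Finset.mul_sum, ← Finset.sum_congr rfl fun h _ ↦ hx h y]
  conv_lhs => rw [← sum_gradedProj 𝒜 (φ y)]
  exact (Fintype.sum_equiv (Equiv.addLeft g) _ _ fun h ↦ rfl).symm

/-- A nonzero component of s is multiplied by an element of opposite degree into a nonzero element t
of S_0 = R; then r t = 0 in a domain. -/
lemma eq_zero_or_eq_zero_of_smul_eq_zero [IsDomain R] (r : R) (s : S) (h : r • s = 0) :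
    r = 0 ∨ s = 0 := by
  refine or_iff_not_imp_right.2 fun hs ↦ ?_
  obtain ⟨g, hg⟩ : ∃ g, gradedProj 𝒜 g s ≠ 0 := by
    by_contra! h
    exact hs (eq_zero_of_gradedProj 𝒜 h)
  obtain ⟨y, hy, hys⟩ : ∃ y ∈ 𝒜 (-g), y * gradedProj 𝒜 g s ≠ 0 := by
    by_contra! h
    exact hg (h𝒜.eq_zero_of_forall_mul (-g) h)
  have hmem : y * gradedProj 𝒜 g s ∈ 𝒜 0 := by
    have := SetLike.mul_mem_graded hy (gradedProj_mem 𝒜 g s)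
    rwa [neg_add_cancel] at this
  obtain ⟨t, ht⟩ := h𝒜.bijective_zero.2 ⟨_, hmem⟩
  have ht' : algebraMap R S t = y * gradedProj 𝒜 g s := congrArg Subtype.val ht
  have ht0 : t ≠ 0 := by
    rintro rfl
    exact hys (by rw [← ht', map_zero])
  have h0 : algebraMap R (𝒜 0) (r * t) = algebraMap R (𝒜 0) 0 := by
    apply Subtype.ext
    change algebraMap R S (r * t) = algebraMap R S 0
    rw [map_mul, ht', ← Algebra.smul_def, ← mul_smul_comm, ← map_smul, h, map_zero, mul_zero,
      map_zero]
  exact (mul_eq_zero.1 (h𝒜.bijective_zero.1 h0)).resolve_right ht0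

end IsStronglyGraded

section Reflexive

variable {N : Type*} [AddCommGroup N] [Module S N] [Module R N] [IsScalarTower R S N]
  (hN : Module.IsReflexive S N)
include hN

omit [Module R N] [IsScalarTower R S N] in
lemma eq_zero_of_forall_smul (g : G) {n : N} (hn : ∀ y ∈ 𝒜 g, y • n = 0) : n = 0 :=
  eq_zero_of_forall_dual hN fun f ↦ h𝒜.eq_zero_of_forall_mul g fun y hy ↦ by
    rw [← smul_eq_mul, ← map_smul, hn y hy, map_zero]

/-- Composing φ with each functional f on N gives a map S_g → S, that is, multiplication by some s
f. As f ↦ s f is S-linear, it lies in the bidual of N and is represented by an element of N. -/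
lemma exists_forall_smul (g : G) (φ : 𝒜 g →ₗ[R] N) : ∃ n : N, ∀ y : 𝒜 g, φ y = (y : S) • n := by
  choose s hs using fun f : Module.Dual S N ↦ h𝒜.exists_forall_mul g (f.restrictScalars R ∘ₗ φ)
  replace hs (f : Module.Dual S N) (y : 𝒜 g) : f (φ y) = y * s f := hs f y
  have huniq {x y : S} (h : ∀ z : 𝒜 g, (z : S) * x = z * y) : x = y :=
    sub_eq_zero.1 (h𝒜.eq_zero_of_forall_mul g fun z hz ↦ by rw [mul_sub, h ⟨z, hz⟩, sub_self])
  let F : Module.Dual S (Module.Dual S N) :=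
    { toFun := s
      map_add' := fun f f' ↦ huniq fun z ↦ by rw [← hs, mul_add, ← hs, ← hs, LinearMap.add_apply]
      map_smul' := fun c f ↦ huniq fun z ↦ by
        rw [← hs, LinearMap.smul_apply, hs, RingHom.id_apply, smul_eq_mul, smul_eq_mul,
          mul_left_comm] }
  obtain ⟨n, hn⟩ := (Module.bijective_dual_eval S N).2 F
  have hn' (f : Module.Dual S N) : f n = s f := LinearMap.congr_fun hn f
  refine ⟨n, fun y ↦ sub_eq_zero.1 (eq_zero_of_forall_dual hN fun f ↦ ?_)⟩
  rw [map_sub, hs, map_smul, hn', smul_eq_mul, sub_self]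

variable (𝒩 : G → Submodule R N) [DirectSum.Decomposition 𝒩] [SetLike.GradedSMul 𝒜 𝒩]

omit [IsScalarTower R S N] in
-- S_(h-k) moves N_k into N_h, and multiplication by S_(h-k) detects zero in N.
lemma end_eq_zero_of_forall_mem (h : G) (b : Module.End S N) (hb : ∀ n ∈ 𝒩 h, b n = 0) : b = 0 := by
  have key (k : G) : ∀ n ∈ 𝒩 k, b n = 0 := fun n hn ↦
    eq_zero_of_forall_smul h𝒜 hN (h - k) fun y hy ↦ by
      rw [← map_smul]
      exact hb _ (gradedSMul_mem (sub_add_cancel h k) hy hn)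
  ext n
  rw [← sum_gradedProj 𝒩 n, map_sum]
  exact Finset.sum_eq_zero fun k _ ↦ key k _ (gradedProj_mem 𝒩 k n)

omit [IsScalarTower R S N] [SetLike.GradedSMul 𝒜 𝒩] hN h𝒜 in
/-- A map on a graded module is linear if it is linear in homogeneous elements. -/
lemma exists_end_of_forall_homogeneous (f : N →+ N)
    (hf : ∀ g k, ∀ s ∈ 𝒜 g, ∀ n ∈ 𝒩 k, f (s • n) = s • f n) :
    ∃ b : Module.End S N, ∀ n, b n = f n := by
  refine ⟨{ f with map_smul' := fun s n ↦ ?_ }, fun n ↦ rfl⟩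
  change f (s • n) = s • f n
  conv_lhs => rw [← sum_gradedProj 𝒜 s, ← sum_gradedProj 𝒩 n]
  conv_rhs => rw [← sum_gradedProj 𝒜 s, ← sum_gradedProj 𝒩 n]
  simp only [Finset.sum_smul, Finset.smul_sum, map_sum]
  exact Finset.sum_congr rfl fun k _ ↦ Finset.sum_congr rfl fun g _ ↦
    hf _ _ _ (gradedProj_mem 𝒜 g s) _ (gradedProj_mem 𝒩 k n)

/-- On N_k the value b n is forced by y • b n = φ(y • n) for y in S_(h-k), because y • n lies in
N_h; such a value exists by `exists_forall_smul`. -/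
lemma exists_end_eq_on (h : G) (φ : N →ₗ[R] N) :
    ∃ b : Module.End S N, ∀ n ∈ 𝒩 h, b n = φ n := by
  have hex (k : G) (n : N) : ∃ x : N, ∀ y ∈ 𝒜 (h - k), y • x = φ (y • gradedProj 𝒩 k n) := by
    obtain ⟨x, hx⟩ := exists_forall_smul h𝒜 hN (h - k)
      (φ ∘ₗ (LinearMap.toSpanSingleton S N (gradedProj 𝒩 k n)).restrictScalars R ∘ₗ
        (𝒜 (h - k)).subtype)
    exact ⟨x, fun y hy ↦ (hx ⟨y, hy⟩).symm⟩
  choose x hx using hex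
  have huniq {k : G} {m m' : N} (he : ∀ y ∈ 𝒜 k, y • m = y • m') : m = m' :=
    sub_eq_zero.1 (eq_zero_of_forall_smul h𝒜 hN k fun y hy ↦ by rw [smul_sub, he y hy, sub_self])
  let f : N →+ N :=
    { toFun := fun n ↦ ∑ k, x k n
      map_zero' := Finset.sum_eq_zero fun k _ ↦ huniq fun y hy ↦ by
        rw [hx k _ y hy, map_zero, smul_zero, map_zero]
      map_add' := fun n n' ↦ by
        rw [← Finset.sum_add_distrib]
        refine Finset.sum_congr rfl fun k _ ↦ huniq (k := h - k) fun y hy ↦ ?_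
        rw [hx k _ y hy, map_add, smul_add, smul_add, map_add, hx k _ y hy, hx k _ y hy] }
  have hf {k : G} {n : N} (hn : n ∈ 𝒩 k) : f n = x k n := by
    refine Finset.sum_eq_single k (fun l _ hl ↦ huniq (k := h - l) fun y hy ↦ ?_) (by simp)
    rw [hx l _ y hy, gradedProj_of_mem 𝒩 hn, if_neg hl.symm]; simp
  have hx' {k : G} {n : N} (hn : n ∈ 𝒩 k) : ∀ y ∈ 𝒜 (h - k), y • x k n = φ (y • n) := by
    intro y hy
    rw [hx k n y hy, gradedProj_of_mem 𝒩 hn, if_pos rfl]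
  obtain ⟨b, hb⟩ := exists_end_of_forall_homogeneous (𝒜 := 𝒜) 𝒩 f fun g k s hs n hn ↦ by
    have hsn := gradedSMul_mem (𝒩 := 𝒩) rfl hs hn
    rw [hf hn, hf hsn]
    refine huniq (k := h - (g + k)) fun y hy ↦ ?_
    rw [hx' hsn y hy, ← smul_assoc, smul_eq_mul, ← smul_assoc, smul_eq_mul, hx' hn]
    have := SetLike.mul_mem_graded hy hs
    rwa [show h - (g + k) + g = h - k by abel] at this
  refine ⟨b, fun n hn ↦ ?_⟩
  rw [hb, hf hn]
  -- For k = h the element y = 1 is allowed and recovers φ.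
  have := hx' hn 1 (by rw [sub_self]; exact SetLike.GradedOne.one_mem)
  rwa [one_smul, one_smul] at this

omit hN h𝒜 in
include 𝒜 in
variable (𝒜) in
lemma exists_homogeneous_end (b : Module.End S N) (g : G) :
    ∃ c : Module.End S N, ∀ n, c n = ∑ h, gradedProj 𝒩 (h + g) (b (gradedProj 𝒩 h n)) := by
  let f : N →ₗ[R] N := ∑ h, gradedProj 𝒩 (h + g) ∘ₗ b.restrictScalars R ∘ₗ gradedProj 𝒩 h
  have hf (n : N) : f n = ∑ h, gradedProj 𝒩 (h + g) (b (gradedProj 𝒩 h n)) := by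
    simp [f]
  obtain ⟨c, hc⟩ := exists_end_of_forall_homogeneous (𝒜 := 𝒜) 𝒩 f.toAddMonoidHom fun j k s hs n _ ↦ by
    change f _ = s • f _
    rw [hf, hf, Finset.smul_sum]
    refine (Fintype.sum_equiv (Equiv.addLeft j) _ _ fun h ↦ ?_).symm
    rw [Equiv.coe_addLeft, gradedProj_smul hs h _ rfl, map_smul,
      gradedProj_smul hs (h + g) _ (add_assoc _ _ _).symm]
  exact ⟨c, fun n ↦ (hc n).trans (hf n)⟩

end Reflexive

end StronglyGraded

/-! ### Reflexivity over the degree zero part -/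

section ReflexiveDescent

variable {G : Type*} [AddCommGroup G] [DecidableEq G] [Fintype G] {R S : Type u} [CommRing R]
  [CommRing S] [Algebra R S] {𝒜 : G → Submodule R S} [GradedAlgebra 𝒜] (h𝒜 : IsStronglyGraded 𝒜)
include h𝒜

/-- The projection to the degree zero part of a strongly graded ring identifies the ring with its
dual over the degree zero part. -/
lemma exists_trace_of_isStronglyGraded : ∃ π : S →ₗ[R] R,
    (∀ s, (∀ x, π (x * s) = 0) → s = 0) ∧ ∀ l : S →ₗ[R] R, ∃ s, ∀ x, l x = π (x * s) := by
  let e : R ≃ₗ[R] 𝒜 0 := LinearEquiv.ofBijective (Algebra.linearMap R (𝒜 0)) h𝒜.bijective_zero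
  have he (r : R) : ((e r : 𝒜 0) : S) = algebraMap R S r := rfl
  let π : S →ₗ[R] R := e.symm.toLinearMap ∘ₗ
    (gradedProj 𝒜 0).codRestrict (𝒜 0) (gradedProj_mem 𝒜 0)
  have hπ (s : S) : algebraMap R S (π s) = gradedProj 𝒜 0 s := by
    rw [← he]
    exact congrArg Subtype.val (e.apply_symm_apply _)
  have hinj : Function.Injective (algebraMap R S) := fun a b hab ↦
    h𝒜.bijective_zero.1 (Subtype.ext hab)
  have hπ' {g : G} {x : S} (hx : x ∈ 𝒜 g) (s : S) :
      algebraMap R S (π (x * s)) = x * gradedProj 𝒜 (-g) s := by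
    rw [hπ, ← smul_eq_mul, gradedProj_smul (𝒩 := 𝒜) hx (-g) 0 (add_neg_cancel g), smul_eq_mul]
  refine ⟨π, fun s hs ↦ eq_zero_of_gradedProj 𝒜 fun g ↦
    h𝒜.eq_zero_of_forall_mul (-g) fun y hy ↦ ?_, fun l ↦ ?_⟩
  · have := hπ' hy s
    rwa [hs, map_zero, neg_neg, eq_comm] at this
  · have hex (g : G) := h𝒜.exists_forall_mul g (Algebra.linearMap R S ∘ₗ l ∘ₗ (𝒜 g).subtype)
    choose x hx using hex
    replace hx (g : G) (y : S) (hy : y ∈ 𝒜 g) : algebraMap R S (l y) = y * x g := hx g ⟨y, hy⟩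
    -- On S_g the functional l is multiplication by x g with values in S_0, so only the component of
    -- x g in degree -g matters.
    refine ⟨∑ g, gradedProj 𝒜 (-g) (x g), fun y ↦ ?_⟩
    rw [← sum_gradedProj 𝒜 y, map_sum, Finset.sum_mul, map_sum]
    refine Finset.sum_congr rfl fun g _ ↦ hinj ?_
    have hy := gradedProj_mem 𝒜 g y
    rw [hπ' hy, map_sum, Finset.sum_eq_single g, gradedProj_gradedProj, if_pos rfl]
    · have h1 := hx g _ hy
      have h2 : gradedProj 𝒜 0 (algebraMap R S (l (gradedProj 𝒜 g y))) = algebraMap R S _ :=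
        (gradedProj_of_mem 𝒜 (e (l (gradedProj 𝒜 g y))).2 0).trans (if_pos rfl)
      rw [← h2, h1, ← smul_eq_mul, gradedProj_smul (𝒩 := 𝒜) hy (-g) 0 (add_neg_cancel g),
        smul_eq_mul]
    · intro h _ hne
      rw [gradedProj_gradedProj, if_neg (by simpa using hne)]
    · simp

/-- Reflexive modules over a strongly graded ring are reflexive over the degree zero part. -/
lemma isReflexive_of_isStronglyGraded {N : Type u} [AddCommGroup N] [Module S N] [Module R N]
    [IsScalarTower R S N] (hN : Module.IsReflexive S N) : Module.IsReflexive R N := by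
  obtain ⟨π, hπ0, hπ⟩ := exists_trace_of_isStronglyGraded h𝒜
  have huniq {s t : S} (h : ∀ x, π (x * s) = π (x * t)) : s = t :=
    sub_eq_zero.1 (hπ0 _ fun x ↦ by rw [mul_sub, map_sub, h, sub_self])
  -- Since S ≅ Hom_R(S, R) through π, adjunction gives Hom_R(X, R) ≅ Hom_S(X, S): R-duals are
  -- S-duals composed with π. Applied to N and to its S-dual, this identifies the biduals.
  have key {X : Type u} [AddCommGroup X] [Module S X] [Module R X] [IsScalarTower R S X]
      (l : X →ₗ[R] R) : ∃ f : X →ₗ[S] S, ∀ x, l x = π (f x) := by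
    choose f hf using fun x : X ↦ hπ (l ∘ₗ (LinearMap.toSpanSingleton S X x).restrictScalars R)
    replace hf (x : X) (s : S) : l (s • x) = π (s * f x) := hf x s
    refine ⟨{ toFun := f, map_add' := fun x y ↦ huniq fun s ↦ ?_,
              map_smul' := fun c x ↦ huniq fun s ↦ ?_ }, fun x ↦ ?_⟩
    · rw [← hf, smul_add, map_add, mul_add, map_add, hf, hf]
    · rw [← hf, smul_smul, hf, RingHom.id_apply, smul_eq_mul, mul_assoc]
    · have := hf x 1
      rwa [one_smul, one_mul] at this
  refine ⟨⟨(injective_iff_map_eq_zero _).2 fun n hn ↦ ?_, fun μ ↦ ?_⟩⟩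
  · refine eq_zero_of_forall_dual hN fun f ↦ hπ0 _ fun x ↦ ?_
    rw [← smul_eq_mul, ← map_smul, map_smul, smul_eq_mul]
    have := LinearMap.congr_fun hn (π ∘ₗ LinearMap.mulLeft R x ∘ₗ f.restrictScalars R)
    exact this
  · let Θ : Module.Dual S N →ₗ[R] Module.Dual R N :=
      { toFun := fun f ↦ π ∘ₗ f.restrictScalars R
        map_add' := fun f g ↦ by ext; simp
        map_smul' := fun r f ↦ by ext; simp }
    obtain ⟨F, hF⟩ := key (μ ∘ₗ Θ)
    obtain ⟨n, hn⟩ := (Module.bijective_dual_eval S N).2 F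
    refine ⟨n, LinearMap.ext fun l ↦ ?_⟩
    obtain ⟨f, hf⟩ := key l
    have hl : l = Θ f := LinearMap.ext hf
    have h1 := hF f
    rw [← hn] at h1
    rw [Module.Dual.eval_apply, hf]
    rw [hl]
    exact h1.symm

end ReflexiveDescent

/-! ### The smash product structure of End_R(N) over End_S(N) -/

section Smash

/-- Forgetting linearity over a bigger ring, as a map of endomorphism algebras. -/
def endRestrictScalars (R S N : Type*) [CommRing R] [CommRing S] [Algebra R S] [AddCommGroup N]
    [Module S N] [Module R N] [IsScalarTower R S N] : Module.End S N →ₐ[R] Module.End R N where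
  toFun := LinearMap.restrictScalars R
  map_one' := rfl
  map_mul' _ _ := rfl
  map_zero' := rfl
  map_add' _ _ := rfl
  commutes' _ := rfl

variable {G : Type*} [AddCommGroup G] [DecidableEq G] [Fintype G] {R S N : Type u} [CommRing R]
  [CommRing S] [Algebra R S] {𝒜 : G → Submodule R S} [GradedAlgebra 𝒜] (h𝒜 : IsStronglyGraded 𝒜)
  [AddCommGroup N] [Module S N] [Module R N] [IsScalarTower R S N]
  (𝒩 : G → Submodule R N) [DirectSum.Decomposition 𝒩] [SetLike.GradedSMul 𝒜 𝒩]

include h𝒜 in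
-- An R-linear map is determined by its restrictions to the N_h, and each restriction extends
-- uniquely to an S-linear endomorphism, the coordinate at h.
lemma isSmashExtension_end (hN : Module.IsReflexive S N) :
    IsSmashExtension (endRestrictScalars R S N).toRingHom
      (gradedProj 𝒩 : G → Module.End R N) where
  sum_eq_one := by
    ext n
    rw [LinearMap.sum_apply]
    exact sum_gradedProj 𝒩 n
  mul_eq h k := by
    ext n
    rw [Module.End.mul_apply, gradedProj_gradedProj]
    by_cases hk : h = k
    · simp [hk]
    · simp [hk, Ne.symm hk]
  exists_homogeneous b := by
    choose c hc using exists_homogeneous_end 𝒜 𝒩 b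
    refine ⟨c, ?_, fun g h ↦ ?_⟩
    · ext n
      rw [LinearMap.sum_apply]
      simp only [hc]
      rw [Finset.sum_comm]
      conv_lhs => rw [← sum_gradedProj 𝒩 n, map_sum]
      refine Finset.sum_congr rfl fun h _ ↦ ?_
      conv_lhs => rw [← sum_gradedProj 𝒩 (b _)]
      exact (Fintype.sum_equiv (Equiv.addLeft h) _ _ fun g ↦ rfl).symm
    · ext n
      change c g (gradedProj 𝒩 h n) = gradedProj 𝒩 (h + g) (c g n)
      rw [hc, hc, map_sum]
      refine Finset.sum_congr rfl fun k _ ↦ ?_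
      rw [gradedProj_gradedProj, gradedProj_gradedProj]
      by_cases hk : h = k
      · simp [hk]
      · rw [if_neg hk, if_neg (by simpa using Ne.symm hk), map_zero, map_zero]
  bijective := by
    have happ (b : G → Module.End S N) (n : N) :
        (∑ h, (endRestrictScalars R S N).toRingHom (b h) * gradedProj 𝒩 h : Module.End R N) n =
          ∑ h, b h (gradedProj 𝒩 h n) := by
      rw [LinearMap.sum_apply]
      rfl
    have happ' (b : G → Module.End S N) (h : G) (n : N) (hn : n ∈ 𝒩 h) :
        ∑ k, b k (gradedProj 𝒩 k n) = b h n := by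
      rw [Finset.sum_eq_single h]
      · rw [gradedProj_of_mem 𝒩 hn, if_pos rfl]
      · intro k _ hk
        rw [gradedProj_of_mem 𝒩 hn, if_neg hk.symm, map_zero]
      · simp
    constructor
    · intro b b' hbb
      funext h
      refine sub_eq_zero.1 (end_eq_zero_of_forall_mem h𝒜 hN 𝒩 h _ fun n hn ↦ ?_)
      have := LinearMap.congr_fun hbb n
      simp only [happ] at this
      rw [happ' b h n hn, happ' b' h n hn] at this
      rw [LinearMap.sub_apply, this, sub_self]
    · intro a
      choose b hb using fun h ↦ exists_end_eq_on h𝒜 hN 𝒩 h a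
      refine ⟨b, LinearMap.ext fun n ↦ ?_⟩
      simp only [happ]
      conv_rhs => rw [← sum_gradedProj 𝒩 n, map_sum]
      exact Finset.sum_congr rfl fun h _ ↦ hb h _ (gradedProj_mem 𝒩 h n)

end Smash

/-! ### Base change of smash product extensions -/

section BaseChange

variable {G : Type*} [AddCommGroup G] [DecidableEq G] [Fintype G] {R A B : Type u} [CommRing R]
  [Ring A] [Ring B] [Algebra R A] [Algebra R B] {f : B →ₐ[R] A} {e : G → A}

/-- An algebra of smash product type is free over the smaller ring. -/
noncomputable def IsSmashExtension.linearEquiv (H : IsSmashExtension f.toRingHom e) :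
    (G → B) ≃ₗ[R] A :=
  LinearEquiv.ofBijective
    { toFun := fun b ↦ ∑ h, f (b h) * e h
      map_add' := fun b b' ↦ by
        simp [add_mul, Finset.sum_add_distrib]
      map_smul' := fun r b ↦ by
        simp [Finset.smul_sum] } H.bijective

lemma IsSmashExtension.linearEquiv_apply (H : IsSmashExtension f.toRingHom e) (b : G → B) :
    H.linearEquiv b = ∑ h, f (b h) * e h := rfl

lemma IsSmashExtension.baseChange (H : IsSmashExtension f.toRingHom e) (P : Type u) [CommRing P]
    [Algebra R P] : IsSmashExtension
      (Algebra.TensorProduct.map (AlgHom.id R P) f).toRingHom fun h ↦ (1 : P) ⊗ₜ[R] e h where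
  sum_eq_one := by
    rw [← TensorProduct.tmul_sum, H.sum_eq_one]
    rfl
  mul_eq h k := by
    rw [Algebra.TensorProduct.tmul_mul_tmul, one_mul, H.mul_eq]
    split_ifs
    · rfl
    · rw [TensorProduct.tmul_zero]
  exists_homogeneous x := by
    induction x with
    | zero => exact ⟨0, by simp, by simp⟩
    | tmul p b =>
      obtain ⟨c, hc, hc'⟩ := H.exists_homogeneous b
      refine ⟨fun g ↦ p ⊗ₜ c g, by rw [hc, TensorProduct.tmul_sum], fun g h ↦ ?_⟩
      change (p ⊗ₜ[R] f (c g)) * _ = _ * (p ⊗ₜ[R] f (c g))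
      rw [Algebra.TensorProduct.tmul_mul_tmul, Algebra.TensorProduct.tmul_mul_tmul, one_mul, mul_one]
      exact congrArg _ (hc' g h)
    | add x y hx hy =>
      obtain ⟨c, hc, hc'⟩ := hx
      obtain ⟨d, hd, hd'⟩ := hy
      refine ⟨c + d, by simp [hc, hd, Finset.sum_add_distrib], fun g h ↦ ?_⟩
      rw [Pi.add_apply, map_add, add_mul, mul_add, hc', hd']
  bijective := by
    have h1 : (fun b : G → P ⊗[R] B ↦ ∑ h,
        (Algebra.TensorProduct.map (AlgHom.id R P) f).toRingHom (b h) * (1 : P) ⊗ₜ[R] e h) =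
        (H.linearEquiv.lTensor P) ∘ (TensorProduct.piRight R R P fun _ : G ↦ B).symm := by
      have h2 : (∑ h, (LinearMap.mulRight R ((1 : P) ⊗ₜ[R] e h)) ∘ₗ
          (Algebra.TensorProduct.map (AlgHom.id R P) f).toLinearMap ∘ₗ LinearMap.proj h :
            (G → P ⊗[R] B) →ₗ[R] P ⊗[R] A) ∘ₗ (TensorProduct.piRight R R P fun _ : G ↦ B).toLinearMap
            = (H.linearEquiv.lTensor P).toLinearMap := by
        ext p h b
        simp [H.linearEquiv_apply, TensorProduct.tmul_sum]
      funext b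
      obtain ⟨x, rfl⟩ := (TensorProduct.piRight R R P fun _ : G ↦ B).surjective b
      have := LinearMap.congr_fun h2 x
      rw [Function.comp_apply, LinearEquiv.symm_apply_apply]
      refine Eq.trans ?_ this
      rw [LinearMap.comp_apply, LinearMap.sum_apply]
      rfl
    rw [h1]
    exact (LinearEquiv.bijective _).comp (LinearEquiv.bijective _)

end BaseChange

/-! ### Support, depth and lower bounds at a prime -/

section Support

variable {R : Type u} [CommRing R] (M : Type u) [AddCommGroup M] [Module R M]

lemma nontrivial_localization_iff (p : PrimeSpectrum R) :
    Nontrivial (Localization.AtPrime p.asIdeal ⊗[R] M) ↔ p ∈ Module.support R M := by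
  rw [Module.mem_support_iff]
  exact (LocalizedModule.equivTensorProduct p.asIdeal.primeCompl M).toEquiv.nontrivial_congr.symm

lemma exists_ringKrullDim_eq_nat [IsNoetherianRing R] (p : Ideal R) [p.IsPrime] :
    ∃ n : ℕ, ringKrullDim (Localization.AtPrime p) = n := by
  rw [IsLocalization.AtPrime.ringKrullDim_eq_height p]
  obtain ⟨n, hn⟩ := ENat.ne_top_iff_exists.1 (Ideal.height_ne_top (I := p) Ideal.IsPrime.ne_top')
  exact ⟨n, by rw [← hn]; rfl⟩

variable {M}

lemma hasDepthAt_iff_localDepth_eq [IsNoetherianRing R] [Module.Finite R M] {p : PrimeSpectrum R}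
    (hp : p ∈ Module.support R M) {n : ℕ}
    (hn : ringKrullDim (Localization.AtPrime p.asIdeal) = n) :
    HasDepthAt p.asIdeal n M ↔ (localDepth (Localization.AtPrime p.asIdeal)
        (Localization.AtPrime p.asIdeal ⊗[R] M) : WithBot ℕ∞) =
      ringKrullDim (Localization.AtPrime p.asIdeal) := by
  have := (nontrivial_localization_iff M p).2 hp
  rw [localDepth_eq_ringKrullDim_iff _ n hn, hasDepthAt_iff]

/-- Needed because primes of S above a prime in the support of A need not lie in the support of B.
-/
lemma hasDepthAt_of_notMem_support {p : PrimeSpectrum R} (hp : p ∉ Module.support R M) (n : ℕ) :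
    HasDepthAt p.asIdeal n M := by
  rw [← nontrivial_localization_iff, not_nontrivial_iff_subsingleton] at hp
  exact (hasDepthAt_iff _ n).2 ⟨List.replicate n 0, fun r hr ↦ by simp [(List.mem_replicate.1 hr).2],
      isWeaklyRegular_of_subsingleton _ _, by simp⟩

lemma HasDepthAt.le_selfInjDim [IsNoetherianRing R] {A : Type u} [Ring A] [Algebra R A]
    [Module.Finite R A] {p : PrimeSpectrum R} (hp : p ∈ Module.support R A) {n : ℕ}
    (h : HasDepthAt p.asIdeal n A) :
    n ≤ selfInjDim (Localization.AtPrime p.asIdeal ⊗[R] A) := by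
  have := (nontrivial_localization_iff A p).2 hp
  obtain ⟨rs, hm, hrs, rfl⟩ := (hasDepthAt_iff _ n).1 h
  exact length_le_selfInjDim rs
    (RingTheory.Sequence.IsRegular.of_isWeaklyRegular_of_mem_maximalIdeal _ hm hrs)

lemma IsCMModule.ringKrullDim_le_selfInjDim [IsNoetherianRing R] {A : Type u} [Ring A]
    [Algebra R A] (h : IsCMModule R A) {p : PrimeSpectrum R} (hp : p ∈ Module.support R A) :
    ringKrullDim (Localization.AtPrime p.asIdeal) ≤
      selfInjDim (Localization.AtPrime p.asIdeal ⊗[R] A) := by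
  have := h.finite
  obtain ⟨n, hn⟩ := exists_ringKrullDim_eq_nat p.asIdeal
  rw [hn]
  exact ((hasDepthAt_iff_localDepth_eq hp hn).2 (h.depth_eq p hp)).le_selfInjDim hp

end Support

/-! ### From a prime of R to the primes of S above it -/

section FibreLocalization

variable {R S : Type u} [CommRing R] [CommRing S] [Algebra R S] (B : Type u) [Ring B] [Algebra R B]
  [Algebra S B] [IsScalarTower R S B] (P : Type u) [CommRing P] [Algebra R P]

/-- The base change of an `S`-algebra along an algebra over a base ring of `S`, as an
`S`-algebra. -/
@[reducible]
noncomputable def baseChangeAlgebra : Algebra S (P ⊗[R] B) :=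
  ((Algebra.TensorProduct.includeRight : B →ₐ[R] P ⊗[R] B).toRingHom.comp
    (algebraMap S B)).toAlgebra' fun s x ↦ by
      induction x with
      | zero => simp
      | tmul p b =>
        change ((1 : P) ⊗ₜ[R] algebraMap S B s) * _ = _ * ((1 : P) ⊗ₜ[R] algebraMap S B s)
        rw [Algebra.TensorProduct.tmul_mul_tmul, Algebra.TensorProduct.tmul_mul_tmul, one_mul,
          mul_one, Algebra.commutes]
      | add x y hx hy => rw [mul_add, add_mul, hx, hy]

variable (p : Ideal R) [p.IsPrime] (q : Ideal S) [q.IsPrime] [q.LiesOver p]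

/-- The complement of p maps into that of q, so B_q is a further localization of B_p at elements of
S. -/
lemma exists_fibreLocalization :
    letI := baseChangeAlgebra (R := R) (S := S) B (Localization.AtPrime p)
    ∃ α : Localization.AtPrime p ⊗[R] B →ₐ[S] Localization.AtPrime q ⊗[S] B,
      IsLocalizedModule q.primeCompl α.toLinearMap := by
  let := baseChangeAlgebra (R := R) (S := S) B (Localization.AtPrime p)
  have halg (s : S) : algebraMap S (Localization.AtPrime p ⊗[R] B) s = 1 ⊗ₜ algebraMap S B s := rfl
  let f : Localization.AtPrime p →ₐ[R] Localization.AtPrime q :=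
    IsLocalization.liftAlgHom (M := p.primeCompl) (f := Algebra.ofId R (Localization.AtPrime q))
      fun w ↦ by
        rw [Algebra.ofId_apply, IsScalarTower.algebraMap_apply R S]
        exact IsLocalization.map_units (Localization.AtPrime q)
          (⟨_, algebraMap_notMem_of_liesOver p q w.2⟩ : q.primeCompl)
  let α₀ : Localization.AtPrime p ⊗[R] B →ₐ[R] Localization.AtPrime q ⊗[S] B :=
    Algebra.TensorProduct.lift
      (((Algebra.TensorProduct.includeLeft :
        Localization.AtPrime q →ₐ[S] Localization.AtPrime q ⊗[S] B).restrictScalars R).comp f)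
      ((Algebra.TensorProduct.includeRight :
        B →ₐ[S] Localization.AtPrime q ⊗[S] B).restrictScalars R)
      fun x b ↦ by
        change (f x ⊗ₜ[S] (1 : B)) * (1 ⊗ₜ[S] b) = (1 ⊗ₜ[S] b) * (f x ⊗ₜ[S] (1 : B))
        simp
  have hα₀ (b : B) : α₀ (1 ⊗ₜ b) = 1 ⊗ₜ b := by simp [α₀]
  let α : Localization.AtPrime p ⊗[R] B →ₐ[S] Localization.AtPrime q ⊗[S] B :=
    { α₀ with
      commutes' := fun s ↦ by
        change α₀ (1 ⊗ₜ algebraMap S B s) = _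
        rw [hα₀, Algebra.TensorProduct.algebraMap_apply, Algebra.algebraMap_eq_smul_one,
          Algebra.algebraMap_eq_smul_one, TensorProduct.smul_tmul] }
  have hα (b : B) : α (1 ⊗ₜ b) = 1 ⊗ₜ b := hα₀ b
  let jp : B →ₗ[R] Localization.AtPrime p ⊗[R] B := TensorProduct.mk R _ B 1
  let jq : B →ₗ[S] Localization.AtPrime q ⊗[S] B := TensorProduct.mk S _ B 1
  have hs (s : S) (b : B) : s • jp b = jp (s • b) := by
    rw [Algebra.smul_def, halg, Algebra.smul_def]
    exact (Algebra.TensorProduct.tmul_mul_tmul _ _ _ _).trans (by rw [one_mul]; rfl)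
  have hr (r : R) (x : Localization.AtPrime p ⊗[R] B) : r • x = algebraMap R S r • x := by
    rw [Algebra.smul_def (algebraMap R S r), halg, ← IsScalarTower.algebraMap_apply]
    induction x with
    | zero => rw [smul_zero, mul_zero]
    | tmul c b =>
      rw [Algebra.TensorProduct.tmul_mul_tmul, one_mul, ← Algebra.smul_def, TensorProduct.tmul_smul]
    | add x y hx hy => rw [smul_add, mul_add, hx, hy]
  refine ⟨α, ⟨IsLocalizedModule.map_units jq, fun y ↦ ?_, fun {x y} hxy ↦ ?_⟩⟩
  · obtain ⟨⟨b, s⟩, h⟩ := IsLocalizedModule.surj q.primeCompl jq y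
    exact ⟨⟨jp b, s⟩, h.trans (hα b).symm⟩
  · obtain ⟨⟨b, r⟩, h⟩ := IsLocalizedModule.surj p.primeCompl jp (x - y)
    replace h : algebraMap R S r • (x - y) = jp b := (hr r _).symm.trans h
    have h0 : jq b = 0 := by
      refine (hα b).symm.trans ?_
      change α (jp b) = 0
      have hxy' : α x = α y := hxy
      rw [← h, map_smul, map_sub, sub_eq_zero.2 hxy', smul_zero]
    obtain ⟨s, hs0⟩ := (IsLocalizedModule.eq_zero_iff q.primeCompl jq).1 h0
    have hw : algebraMap R S r ∉ q := algebraMap_notMem_of_liesOver p q r.2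
    refine ⟨s * ⟨_, hw⟩, ?_⟩
    change ((s : S) * algebraMap R S r) • x = ((s : S) * algebraMap R S r) • y
    rw [Algebra.smul_def, Algebra.smul_def, ← sub_eq_zero, ← mul_sub, ← Algebra.smul_def, mul_smul]
    refine (congrArg ((s : S) • ·) h).trans ((hs s b).trans ?_)
    exact (congrArg jp hs0).trans (map_zero jp)

variable {B} in
lemma isNoetherianRing_baseChange [IsNoetherianRing P] [Module.Finite R B] :
    IsNoetherianRing (P ⊗[R] B) :=
  isNoetherian_of_tower P (inferInstance : IsNoetherian P (P ⊗[R] B))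

/-- The primes of `S` over `p` are jointly dense for localization over `p`. -/
lemma exists_isUnit_of_forall_liesOver [Algebra.IsIntegral R S] (J : Ideal S)
    (hJ : ∀ q : {q : PrimeSpectrum S // q.asIdeal.LiesOver p}, ∃ w ∈ q.1.asIdeal.primeCompl, w ∈ J) :
    ∃ u ∈ J, IsUnit ((1 : Localization.AtPrime p) ⊗ₜ[R] algebraMap S B u) := by
  obtain ⟨r, hr, hrJ⟩ : ∃ r ∉ p, algebraMap R S r ∈ J := by
    by_contra! h
    obtain ⟨q, hJq, hq, hqp⟩ := exists_le_liesOver p J h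
    obtain ⟨w, hw, hwJ⟩ := hJ ⟨⟨q, hq⟩, hqp⟩
    exact hw (hJq hwJ)
  refine ⟨_, hrJ, ?_⟩
  rw [← IsScalarTower.algebraMap_apply, Algebra.algebraMap_eq_smul_one,
    ← TensorProduct.smul_tmul, ← Algebra.algebraMap_eq_smul_one]
  exact (IsLocalization.map_units (Localization.AtPrime p) (⟨r, hr⟩ : p.primeCompl)).map
    (Algebra.TensorProduct.includeLeft : _ →ₐ[R] Localization.AtPrime p ⊗[R] B)

variable [IsNoetherianRing R] [Module.Finite R S] [Module.Finite R B]

/-- B_p is noetherian, and an ideal of S that is contained in no prime above p contains an element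
from R outside p, a unit on B_p. So the primes above p jointly detect injectivity. -/
lemma selfInjDim_le_iff_forall_liesOver (n : ℕ) :
    selfInjDim (Localization.AtPrime p ⊗[R] B) ≤ n ↔ ∀ q : PrimeSpectrum S, q.asIdeal.LiesOver p →
      selfInjDim (Localization.AtPrime q.asIdeal ⊗[S] B) ≤ n := by
  have : IsNoetherianRing (Localization.AtPrime p ⊗[R] B) := isNoetherianRing_baseChange _
  let := baseChangeAlgebra (R := R) (S := S) B (Localization.AtPrime p)
  simp only [selfInjDim_le_iff]
  constructor
  · intro h q hq
    obtain ⟨α, hα⟩ := exists_fibreLocalization B p q.asIdeal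
    exact hasInjectiveDimensionLE_self_of_isLocalizedModule q.asIdeal.primeCompl α n h
  · intro h
    choose α hα using fun q : {q : PrimeSpectrum S // q.asIdeal.LiesOver p} ↦
      haveI := q.2
      exists_fibreLocalization B p q.1.asIdeal
    refine hasInjectiveDimensionLE_of_forall_localizedObj
      (fun q : {q : PrimeSpectrum S // q.asIdeal.LiesOver p} ↦ q.1.asIdeal.primeCompl) _ α
      (exists_isUnit_of_forall_liesOver B p) n _ fun q ↦ ?_
    have := h q.1 q.2
    exact hasInjectiveDimensionLT_of_iso
      (nonempty_localizedObj_self_iso q.1.asIdeal.primeCompl (α q)).some.symm _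

lemma globalDim_le_iff_forall_liesOver (n : ℕ) :
    globalDim (Localization.AtPrime p ⊗[R] B) ≤ n ↔ ∀ q : PrimeSpectrum S, q.asIdeal.LiesOver p →
      globalDim (Localization.AtPrime q.asIdeal ⊗[S] B) ≤ n := by
  have : IsNoetherianRing (Localization.AtPrime p ⊗[R] B) := isNoetherianRing_baseChange _
  let := baseChangeAlgebra (R := R) (S := S) B (Localization.AtPrime p)
  simp only [globalDim_le_iff]
  constructor
  · intro h q hq
    obtain ⟨α, hα⟩ := exists_fibreLocalization B p q.asIdeal
    exact forall_hasInjectiveDimensionLE_of_isLocalizedModule q.asIdeal.primeCompl α n h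
  · intro h Y
    choose α hα using fun q : {q : PrimeSpectrum S // q.asIdeal.LiesOver p} ↦
      haveI := q.2
      exists_fibreLocalization B p q.1.asIdeal
    exact hasInjectiveDimensionLE_of_forall_localizedObj
      (fun q : {q : PrimeSpectrum S // q.asIdeal.LiesOver p} ↦ q.1.asIdeal.primeCompl) _ α
      (exists_isUnit_of_forall_liesOver B p) n _ fun q ↦ h q.1 q.2 _

end FibreLocalization

/-! ### Invariants of A and B at a prime of R -/

section DepthSmash

variable {G : Type*} [AddCommGroup G] [Fintype G] [DecidableEq G] {R A B : Type u} [CommRing R]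
  [Ring A] [Ring B] [Algebra R A] [Algebra R B] {f : B →ₐ[R] A} {e : G → A}

lemma IsSmashExtension.hasDepthAt_iff (H : IsSmashExtension f.toRingHom e) (p : Ideal R)
    [p.IsPrime] (n : ℕ) : HasDepthAt p n A ↔ HasDepthAt p n B := by
  let ε : (Fin (Fintype.card G) → B) ≃ₗ[R] A :=
    (LinearEquiv.funCongrLeft R B (Fintype.equivFin G)).trans H.linearEquiv
  let i : Fin (Fintype.card G) := Fintype.equivFin G 0
  constructor
  · intro h
    exact (h.of_linearEquiv p n ε.symm).of_retract p n (LinearMap.single R (fun _ ↦ B) i)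
      (LinearMap.proj i) (by ext; simp)
  · intro h
    exact (h.pi p (Fin (Fintype.card G)) n).of_linearEquiv p n ε

variable (H : IsSmashExtension f.toRingHom e) (p : Ideal R) [p.IsPrime]
include H

lemma IsSmashExtension.selfInjDim_localization_le_iff (n : ℕ) :
    selfInjDim (Localization.AtPrime p ⊗[R] A) ≤ n ↔
      selfInjDim (Localization.AtPrime p ⊗[R] B) ≤ n := by
  have H' := H.baseChange (Localization.AtPrime p)
  rw [selfInjDim_le_iff, selfInjDim_le_iff]
  exact ⟨H'.hasInjectiveDimensionLE_self_left n, H'.hasInjectiveDimensionLE_self n⟩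

lemma IsSmashExtension.globalDim_localization_le (n : ℕ)
    (h : globalDim (Localization.AtPrime p ⊗[R] B) ≤ n) :
    globalDim (Localization.AtPrime p ⊗[R] A) ≤ n := by
  rw [globalDim_le_iff] at h ⊢
  exact (H.baseChange (Localization.AtPrime p)).globalDim_le n h

lemma IsSmashExtension.globalDim_localization_le_left (hG : IsUnit (Nat.card G : R)) (n : ℕ)
    (h : globalDim (Localization.AtPrime p ⊗[R] A) ≤ n) :
    globalDim (Localization.AtPrime p ⊗[R] B) ≤ n := by
  rw [globalDim_le_iff] at h ⊢
  refine (H.baseChange (Localization.AtPrime p)).globalDim_le_left ?_ n h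
  have := hG.map (algebraMap R (Localization.AtPrime p ⊗[R] B))
  rwa [map_natCast, Nat.card_eq_fintype_card] at this

end DepthSmash

lemma globalDim_lt_top_iff_exists_le (A : Type u) [Ring A] :
    globalDim A < ⊤ ↔ ∃ n : ℕ, globalDim A ≤ n := by
  simp only [globalDim_le_iff]
  exact globalDim_lt_top_iff

lemma selfInjDim_le_of_subsingleton (A : Type u) [Ring A] [Subsingleton A] (n : ℕ) :
    selfInjDim A ≤ n :=
  (selfInjDim_le_iff n).2 (hasInjectiveDimensionLE_of_subsingleton n _)

lemma globalDim_le_of_subsingleton (A : Type u) [Ring A] [Subsingleton A] (n : ℕ) :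
    globalDim A ≤ n :=
  (globalDim_le_iff n).2 (hasInjectiveDimensionLE_of_subsingleton n)

lemma IsCMModule.ringKrullDim_le_globalDim {R : Type u} [CommRing R] [IsNoetherianRing R]
    {A : Type u} [Ring A] [Algebra R A] (h : IsCMModule R A) {p : PrimeSpectrum R}
    (hp : p ∈ Module.support R A) : ringKrullDim (Localization.AtPrime p.asIdeal) ≤
      globalDim (Localization.AtPrime p.asIdeal ⊗[R] A) := by
  obtain ⟨n, hn⟩ := exists_ringKrullDim_eq_nat p.asIdeal
  have := h.ringKrullDim_le_selfInjDim hp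
  rw [hn] at this ⊢
  exact le_globalDim_of_le_selfInjDim n this

/-! ### Comparison of A over R with B over S -/

section Comparison

variable {G : Type*} [AddCommGroup G] [Fintype G] [DecidableEq G] {R S A B : Type u} [CommRing R]
  [CommRing S] [Algebra R S] [Ring A] [Ring B] [Algebra R A] [Algebra R B] [Algebra S B]
  [IsScalarTower R S B] {f : B →ₐ[R] A} {e : G → A} (H : IsSmashExtension f.toRingHom e)
  [IsNoetherianRing R] [Module.Finite R S] [Module.Finite S B] [Algebra.HasGoingDown R S]

omit [IsNoetherianRing R] [Module.Finite R S] [Module.Finite S B] [Algebra.HasGoingDown R S] in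
/-- The support of an algebra contains the primes below the support of a subalgebra. -/
lemma mem_support_of_liesOver (hf : Function.Injective f) {p : PrimeSpectrum R}
    {q : PrimeSpectrum S} (hq : q.asIdeal.LiesOver p.asIdeal) (h : q ∈ Module.support S B) :
    p ∈ Module.support R A := by
  rw [Module.mem_support_iff'] at h ⊢
  obtain ⟨b, hb⟩ := h
  refine ⟨f b, fun r hr h0 ↦ hb (algebraMap R S r) (algebraMap_notMem_of_liesOver p.asIdeal _ hr) ?_⟩
  rw [algebraMap_smul]
  exact hf (by rw [map_smul, h0, map_zero])

omit [IsNoetherianRing R] in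
include H in
lemma IsSmashExtension.injective : Function.Injective f := fun x y h ↦ by
  have h1 : f (x - y) = 0 := by rw [map_sub, h, sub_self]
  exact sub_eq_zero.1 (H.eq_zero_of_mul_eq_zero (h := 0) (by
    change f (x - y) * _ = 0
    rw [h1, zero_mul]))

include H in
-- As R-modules A is a finite power of B, so their depths at p agree; depth of B then passes between
-- p and the primes above it, where the dimension is the same.
lemma IsSmashExtension.isCMModule_iff : IsCMModule S B ↔ IsCMModule R A := by
  have : IsNoetherianRing S := IsNoetherianRing.of_finite R S
  have : Module.Finite R B := Module.Finite.trans S B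
  have : Module.Finite R A := Module.Finite.equiv H.linearEquiv
  constructor
  · intro h
    refine ⟨inferInstance, fun p hp ↦ ?_⟩
    obtain ⟨n, hn⟩ := exists_ringKrullDim_eq_nat p.asIdeal
    rw [← hasDepthAt_iff_localDepth_eq hp hn, H.hasDepthAt_iff]
    refine HasDepthAt.of_forall_liesOver (S := S) p.asIdeal n fun q hq hqp ↦ ?_
    by_cases hqB : (⟨q, hq⟩ : PrimeSpectrum S) ∈ Module.support S B
    · refine (hasDepthAt_iff_localDepth_eq hqB ?_).2 (h.depth_eq _ hqB)
      rw [ringKrullDim_localization_eq_of_liesOver p.asIdeal q, hn]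
    · exact hasDepthAt_of_notMem_support hqB n
  · intro h
    refine ⟨inferInstance, fun q hq ↦ ?_⟩
    let p : PrimeSpectrum R := PrimeSpectrum.comap (algebraMap R S) q
    have hqp : q.asIdeal.LiesOver p.asIdeal := ⟨rfl⟩
    have hp : p ∈ Module.support R A := mem_support_of_liesOver H.injective hqp hq
    obtain ⟨n, hn⟩ := exists_ringKrullDim_eq_nat p.asIdeal
    have hn' := (ringKrullDim_localization_eq_of_liesOver p.asIdeal q.asIdeal).trans hn
    rw [← hasDepthAt_iff_localDepth_eq hq hn']
    refine HasDepthAt.of_liesOver p.asIdeal q.asIdeal n ?_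
    rw [← H.hasDepthAt_iff]
    exact (hasDepthAt_iff_localDepth_eq hp hn).2 (h.depth_eq p hp)

include H in
-- The upper bound is collected from the primes above p, those outside the support contributing zero
-- rings; the lower bound is the regular sequence bound for A.
lemma IsSmashExtension.selfInjDim_eq (hB : IsCMModule S B)
    (h : ∀ q ∈ Module.support S B, selfInjDim (Localization.AtPrime q.asIdeal ⊗[S] B) =
      ringKrullDim (Localization.AtPrime q.asIdeal))
    (p : PrimeSpectrum R) (hp : p ∈ Module.support R A) :
    selfInjDim (Localization.AtPrime p.asIdeal ⊗[R] A) =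
      ringKrullDim (Localization.AtPrime p.asIdeal) := by
  have : IsNoetherianRing S := IsNoetherianRing.of_finite R S
  have : Module.Finite R B := Module.Finite.trans S B
  refine le_antisymm ?_ ((H.isCMModule_iff.1 hB).ringKrullDim_le_selfInjDim hp)
  obtain ⟨n, hn⟩ := exists_ringKrullDim_eq_nat p.asIdeal
  rw [hn, H.selfInjDim_localization_le_iff, selfInjDim_le_iff_forall_liesOver (S := S)]
  intro q hqp
  by_cases hq : q ∈ Module.support S B
  · rw [h q hq, ringKrullDim_localization_eq_of_liesOver p.asIdeal q.asIdeal, hn]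
  · rw [← nontrivial_localization_iff, not_nontrivial_iff_subsingleton] at hq
    exact selfInjDim_le_of_subsingleton _ _

include H in
lemma IsSmashExtension.selfInjDim_eq_left (hA : IsCMModule R A)
    (h : ∀ p ∈ Module.support R A, selfInjDim (Localization.AtPrime p.asIdeal ⊗[R] A) =
      ringKrullDim (Localization.AtPrime p.asIdeal))
    (q : PrimeSpectrum S) (hq : q ∈ Module.support S B) :
    selfInjDim (Localization.AtPrime q.asIdeal ⊗[S] B) =
      ringKrullDim (Localization.AtPrime q.asIdeal) := by
  have : IsNoetherianRing S := IsNoetherianRing.of_finite R S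
  have : Module.Finite R B := Module.Finite.trans S B
  refine le_antisymm ?_ (((H.isCMModule_iff (S := S)).2 hA).ringKrullDim_le_selfInjDim hq)
  let p : PrimeSpectrum R := PrimeSpectrum.comap (algebraMap R S) q
  have hqp : q.asIdeal.LiesOver p.asIdeal := ⟨rfl⟩
  have hp : p ∈ Module.support R A := mem_support_of_liesOver H.injective hqp hq
  obtain ⟨n, hn⟩ := exists_ringKrullDim_eq_nat p.asIdeal
  rw [ringKrullDim_localization_eq_of_liesOver p.asIdeal q.asIdeal, hn]
  refine (selfInjDim_le_iff_forall_liesOver B p.asIdeal n).1 ?_ q hqp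
  rw [← H.selfInjDim_localization_le_iff, h p hp, hn]

include H in
lemma IsSmashExtension.globalDim_eq (hB : IsCMModule S B)
    (h : ∀ q ∈ Module.support S B, globalDim (Localization.AtPrime q.asIdeal ⊗[S] B) =
      ringKrullDim (Localization.AtPrime q.asIdeal))
    (p : PrimeSpectrum R) (hp : p ∈ Module.support R A) :
    globalDim (Localization.AtPrime p.asIdeal ⊗[R] A) =
      ringKrullDim (Localization.AtPrime p.asIdeal) := by
  have : IsNoetherianRing S := IsNoetherianRing.of_finite R S
  have : Module.Finite R B := Module.Finite.trans S B
  refine le_antisymm ?_ ((H.isCMModule_iff.1 hB).ringKrullDim_le_globalDim hp)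
  obtain ⟨n, hn⟩ := exists_ringKrullDim_eq_nat p.asIdeal
  rw [hn]
  refine H.globalDim_localization_le _ n ?_
  rw [globalDim_le_iff_forall_liesOver (S := S)]
  intro q hqp
  by_cases hq : q ∈ Module.support S B
  · rw [h q hq, ringKrullDim_localization_eq_of_liesOver p.asIdeal q.asIdeal, hn]
  · rw [← nontrivial_localization_iff, not_nontrivial_iff_subsingleton] at hq
    exact globalDim_le_of_subsingleton _ _

include H in
lemma IsSmashExtension.globalDim_eq_left (hG : IsUnit (Nat.card G : R)) (hA : IsCMModule R A)
    (h : ∀ p ∈ Module.support R A, globalDim (Localization.AtPrime p.asIdeal ⊗[R] A) =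
      ringKrullDim (Localization.AtPrime p.asIdeal))
    (q : PrimeSpectrum S) (hq : q ∈ Module.support S B) :
    globalDim (Localization.AtPrime q.asIdeal ⊗[S] B) =
      ringKrullDim (Localization.AtPrime q.asIdeal) := by
  have : IsNoetherianRing S := IsNoetherianRing.of_finite R S
  have : Module.Finite R B := Module.Finite.trans S B
  refine le_antisymm ?_ (((H.isCMModule_iff (S := S)).2 hA).ringKrullDim_le_globalDim hq)
  let p : PrimeSpectrum R := PrimeSpectrum.comap (algebraMap R S) q
  have hqp : q.asIdeal.LiesOver p.asIdeal := ⟨rfl⟩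
  have hp : p ∈ Module.support R A := mem_support_of_liesOver H.injective hqp hq
  obtain ⟨n, hn⟩ := exists_ringKrullDim_eq_nat p.asIdeal
  rw [ringKrullDim_localization_eq_of_liesOver p.asIdeal q.asIdeal, hn]
  refine (globalDim_le_iff_forall_liesOver B p.asIdeal n).1 ?_ q hqp
  exact H.globalDim_localization_le_left _ hG n (by rw [h p hp, hn])

omit [Algebra.HasGoingDown R S] in
include H in
lemma IsSmashExtension.globalDim_lt_top
    (h : ∀ q : PrimeSpectrum S, globalDim (Localization.AtPrime q.asIdeal ⊗[S] B) < ⊤)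
    (p : PrimeSpectrum R) : globalDim (Localization.AtPrime p.asIdeal ⊗[R] A) < ⊤ := by
  have : Module.Finite R B := Module.Finite.trans S B
  -- Finiteness at each q becomes a uniform bound over p because the fibre over p is finite.
  have hfin : Finite {q : PrimeSpectrum S // q.asIdeal.LiesOver p.asIdeal} := by
    have := (Algebra.QuasiFinite.finite_primesOver (S := S) p.asIdeal).to_subtype
    exact Finite.of_injective
      (fun q ↦ (⟨q.1.asIdeal, q.1.isPrime, q.2⟩ : p.asIdeal.primesOver S))
      fun q q' hqq ↦ Subtype.ext (PrimeSpectrum.ext (congrArg Subtype.val hqq))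
  choose n hn using fun q ↦ (globalDim_lt_top_iff_exists_le _).1 (h q)
  obtain ⟨m, hm⟩ := Finite.exists_le
    fun q : {q : PrimeSpectrum S // q.asIdeal.LiesOver p.asIdeal} ↦ n q.1
  refine (globalDim_lt_top_iff_exists_le _).2 ⟨m, H.globalDim_localization_le _ m ?_⟩
  rw [globalDim_le_iff_forall_liesOver (S := S)]
  exact fun q hq ↦ (hn q).trans (by exact_mod_cast hm ⟨q, hq⟩)

omit [Algebra.HasGoingDown R S] in
include H in
lemma IsSmashExtension.globalDim_lt_top_left (hG : IsUnit (Nat.card G : R))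
    (h : ∀ p : PrimeSpectrum R, globalDim (Localization.AtPrime p.asIdeal ⊗[R] A) < ⊤)
    (q : PrimeSpectrum S) : globalDim (Localization.AtPrime q.asIdeal ⊗[S] B) < ⊤ := by
  have : Module.Finite R B := Module.Finite.trans S B
  let p : PrimeSpectrum R := PrimeSpectrum.comap (algebraMap R S) q
  have hqp : q.asIdeal.LiesOver p.asIdeal := ⟨rfl⟩
  obtain ⟨n, hn⟩ := (globalDim_lt_top_iff_exists_le _).1 (h p)
  exact (globalDim_lt_top_iff_exists_le _).2 ⟨n, (globalDim_le_iff_forall_liesOver B p.asIdeal n).1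
    (H.globalDim_localization_le_left _ hG n hn) q hqp⟩

end Comparison

theorem mainTheorem4
    {G : Type*} [AddCommGroup G] [Finite G] [DecidableEq G]
    {R S N : Type u}
    [CommRing R] [IsNoetherianRing R] [IsDomain R] [IsIntegrallyClosed R]
    [CommRing S] [Algebra R S] [Module.Finite R S]
    (𝒜 : G → Submodule R S) [GradedAlgebra 𝒜] (h𝒜 : IsStronglyGraded 𝒜)
    [AddCommGroup N] [Module S N] [Module R N] [IsScalarTower R S N]
    (𝒩 : G → Submodule R N) [DirectSum.Decomposition 𝒩] [SetLike.GradedSMul 𝒜 𝒩]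
    (hN : IsReflMod S N) :
    (GivesModification S N ↔ GivesModification R N) ∧
    ((GivesGM S N → GivesGM R N) ∧
      (GivesNCCR S N → GivesNCCR R N) ∧
      (GivesNCR S N → GivesNCR R N)) ∧
    (IsUnit (Nat.card G : R) →
      (GivesGM R N → GivesGM S N) ∧
      (GivesNCCR R N → GivesNCCR S N) ∧
      (GivesNCR R N → GivesNCR S N)) := by
  have := Fintype.ofFinite G
  have : IsNoetherianRing S := IsNoetherianRing.of_finite R S
  have := hN.finite
  have : Module.Finite R N := Module.Finite.trans S N
  have hR : IsReflMod R N := ⟨inferInstance, isReflexive_of_isStronglyGraded h𝒜 hN.reflexive⟩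
  have : Algebra.HasGoingDown R S :=
    hasGoingDown_of_isTorsionFree h𝒜.eq_zero_or_eq_zero_of_smul_eq_zero
  have H := isSmashExtension_end h𝒜 𝒩 hN.reflexive
  refine ⟨⟨fun h ↦ ⟨hR, H.isCMModule_iff.1 h.cm⟩, fun h ↦ ⟨hN, H.isCMModule_iff.2 h.cm⟩⟩,
    ⟨fun h ↦ ⟨hR, H.isCMModule_iff.1 h.cm, H.selfInjDim_eq h.cm h.injDim_eq⟩,
      fun h ↦ ⟨hR, H.isCMModule_iff.1 h.cm, H.globalDim_eq h.cm h.globalDim_eq⟩,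
      fun h ↦ ⟨hR, H.globalDim_lt_top h.globalDim_lt_top⟩⟩,
    fun hG ↦ ⟨fun h ↦ ⟨hN, H.isCMModule_iff.2 h.cm, H.selfInjDim_eq_left h.cm h.injDim_eq⟩,
      fun h ↦ ⟨hN, H.isCMModule_iff.2 h.cm, H.globalDim_eq_left hG h.cm h.globalDim_eq⟩,
      fun h ↦ ⟨hN, H.globalDim_lt_top_left hG h.globalDim_lt_top⟩⟩⟩
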